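/- Let $N\ge 11$ be an integer and set $q_{JL}=\frac{N-2\sqrt{N-1}}{4}$. Let $f\in C^2(\mathbb R\setminus\{0\})\cap C^1(\mathbb R)$ be odd with $f(u)>0$, $f'(u)>0$, $f''(u)>0$ and $F(u):=\int_u^\infty \frac{ds}{f(s)}<\infty$ for all $u>0$. Suppose that the finite limit $q_0=\lim_{u\to 0^+}f'(u)F(u)$ exists and that $1<q_0<q_{JL}$. A solution $U\in C^2(\mathbb R^N)$ of $$\Delta U+f(U)=0\quad\text{in }\mathbb R^N \tag{1.1}$$ is called stable if $\int_{\mathbb R^N}\left(|\nabla\phi|^2-f'(U)\phi^2\right)dx\ge 0$ for every compactly supported $\phi\in C^1(\mathbb R^N)$, and unstable otherwise. Then for every $\alpha>0$ the problem $$u''+\frac{N-1}{r}u'+f(u)=0\ \ (r>0),\qquad u(0)=\alpha,\quad u'(0)=0,$$ has a unique solution $u(\cdot,\alpha)\in C^2([0,\infty))$. There is $\alpha_0>0$ such that for every $\alpha\in(0,\alpha_0)$ the function $x\mapsto u(|x|,\alpha)$ is a stable solution of (1.1). Moreover, one of the following holds (where $u(\cdot,\alpha)$ is called a stable or an unstable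 solution if $x\mapsto u(|x|,\alpha)$ is one): (II) $u(\cdot,\alpha)$ is a stable solution of (1.1) for every $\alpha>0$, and $u(r,\alpha)$ is strictly increasing in $\alpha>0$ for each fixed $r>0$; (III) there is $\alpha^*\in(0,\infty)$ such that $u(\cdot,\alpha)$ is a stable solution of (1.1) for $0<\alpha\le\alpha^*$ and an unstable solution for $\alpha>\alpha^*$, and $u(r,\alpha)$ is strictly increasing in $\alpha\in(0,\alpha^*)$ for each fixed $r>0$. -/

import Mathlib

open Set Filter Topology MeasureTheory

noncomputable section

namespace StableRadial

/-- The improper integral `F(u) = ∫_u^∞ ds / f(s)` (used for `u > 0`). -/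
def F (f : ℝ → ℝ) (u : ℝ) : ℝ := ∫ s in Ioi u, 1 / f s

/-- The standing assumptions on the nonlinearity: `f ∈ C²(ℝ \ {0}) ∩ C¹(ℝ)` is odd, and
`f, f', f'' > 0` and `F < ∞` on `(0, ∞)`.  Since `1 / f` is positive and continuous on `(0, ∞)`,
finiteness of `F(u)` is integrability of `1 / f` on `(u, ∞)`. -/
structure IsNonlinearity (f : ℝ → ℝ) : Prop where
  contDiff_one : ContDiff ℝ 1 f
  contDiffOn_two : ContDiffOn ℝ 2 f {0}ᶜ
  odd : ∀ u, f (-u) = -f u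
  pos : ∀ u, 0 < u → 0 < f u
  deriv_pos : ∀ u, 0 < u → 0 < deriv f u
  deriv_deriv_pos : ∀ u, 0 < u → 0 < deriv (deriv f) u
  integrable : ∀ u, 0 < u → IntegrableOn (fun s => 1 / f s) (Ioi u)

/-- The exponent `q_JL = (N - 2 √(N - 1)) / 4`. -/
def qJL (N : ℕ) : ℝ := ((N : ℝ) - 2 * Real.sqrt ((N : ℝ) - 1)) / 4

/-- `u ∈ C²([0, ∞))` solves `u'' + ((N - 1) / r) u' + f(u) = 0` for `r > 0`, with `u(0) = α` and
`u'(0) = 0` (one-sided derivative).  Only the values of `u` on `[0, ∞)` matter. -/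
structure IsRadialSolution (N : ℕ) (f : ℝ → ℝ) (α : ℝ) (u : ℝ → ℝ) : Prop where
  contDiffOn : ContDiffOn ℝ 2 u (Ici 0)
  ode : ∀ r, 0 < r → deriv (deriv u) r + ((N : ℝ) - 1) / r * deriv u r + f (u r) = 0
  init : u 0 = α
  init_deriv : HasDerivWithinAt u 0 (Ici 0) 0

/-- `U ∈ C²(ℝᴺ)` solves `Δ U + f(U) = 0` in `ℝᴺ`. -/
def IsEntireSolution (N : ℕ) (f : ℝ → ℝ) (U : EuclideanSpace ℝ (Fin N) → ℝ) : Prop :=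
  ContDiff ℝ 2 U ∧ ∀ x, Laplacian.laplacian U x + f (U x) = 0

/-- `∫ (|∇φ|² - f'(U) φ²) dx ≥ 0` for every compactly supported `φ ∈ C¹(ℝᴺ)`. -/
def StabilityInequality (N : ℕ) (f : ℝ → ℝ) (U : EuclideanSpace ℝ (Fin N) → ℝ) : Prop :=
  ∀ φ : EuclideanSpace ℝ (Fin N) → ℝ, ContDiff ℝ 1 φ → HasCompactSupport φ →
    0 ≤ ∫ x, (‖gradient φ x‖ ^ 2 - deriv f (U x) * φ x ^ 2)

/-- `U` is a stable solution of `Δ U + f(U) = 0` in `ℝᴺ`. -/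
def IsStableSolution (N : ℕ) (f : ℝ → ℝ) (U : EuclideanSpace ℝ (Fin N) → ℝ) : Prop :=
  IsEntireSolution N f U ∧ StabilityInequality N f U

/-- `U` is an unstable (that is, not stable) solution of `Δ U + f(U) = 0` in `ℝᴺ`. -/
def IsUnstableSolution (N : ℕ) (f : ℝ → ℝ) (U : EuclideanSpace ℝ (Fin N) → ℝ) : Prop :=
  IsEntireSolution N f U ∧ ¬ StabilityInequality N f U

/-- The radial function `x ↦ u(|x|)` on `ℝᴺ`. -/
def radial (N : ℕ) (u : ℝ → ℝ) : EuclideanSpace ℝ (Fin N) → ℝ := fun x => u ‖x‖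

/-- Structure (II) for a family `u α r = u(r, α)`: every `u(·, α)`, `α > 0`, is stable, and
`u(r, α)` is strictly increasing in `α > 0` for each fixed `r > 0`. -/
def StructureII (N : ℕ) (f : ℝ → ℝ) (u : ℝ → ℝ → ℝ) : Prop :=
  (∀ α, 0 < α → IsStableSolution N f (radial N (u α))) ∧
    ∀ r, 0 < r → StrictMonoOn (fun α => u α r) (Ioi 0)

/-- Structure (III) for a family `u α r = u(r, α)`: there is a threshold `α* ∈ (0, ∞)` such that
`u(·, α)` is stable for `0 < α ≤ α*` and unstable for `α > α*`, and `u(r, α)` is strictly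
increasing in `α ∈ (0, α*)` for each fixed `r > 0`. -/
def StructureIII (N : ℕ) (f : ℝ → ℝ) (u : ℝ → ℝ → ℝ) : Prop :=
  ∃ αs : ℝ, 0 < αs ∧
    (∀ α ∈ Ioc 0 αs, IsStableSolution N f (radial N (u α))) ∧
    (∀ α, αs < α → IsUnstableSolution N f (radial N (u α))) ∧
    ∀ r, 0 < r → StrictMonoOn (fun α => u α r) (Ioo 0 αs)

end StableRadial

end

/-! Everything rests on one substitution and one comparison principle.

Existence comes from Picard iteration for a truncated nonlinearity. The energy `u'^2/2 + ∫₀^u f`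
decreases in `r`, so `|u| ≤ α` and the truncation is never active. Uniqueness and continuous
dependence on `α` come from Gronwall, since the singular damping term has the good sign.

For small `α`, put `v = F(u)`. Then `v'' + (N-1)v'/r = 1 + f'(u) v'^2`, where `f'(u) v = f'(u)F(u)`
is close to `q₀`. If this product were a constant `q`, then `r²/(2N-4q)` would be an explicit
solution. Below the Joseph-Lundgren exponent the linearisation at that solution does not oscillate,
and `v` stays above it (`sq_lt_mul_of_josephLundgren`). Hence `r² f'(u) ≤ q₂(2N-4q₁)`, where `q₁,
q₂` are pinching bounds near `q₀`. The same condition on `q₀` puts this below the Hardy constant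
`(N-2)²/4`, so `hardy_inequality` gives stability (`stabilityInequality_of_pinching`).

For the global structure, suppose `v` is stable and `u` starts lower. By convexity of `f`, both `u`
and `v - u` are strict subsolutions of the equation linearised at `v`. A first zero of either would
give a test function of negative energy (`exists_test_function_neg`), so `0 < u < v`. Since `f'`
increases on `[0,∞)`, `u` is stable too. The stable parameters thus form an interval starting at
`0`. It is closed from below by dominated convergence, which leaves exactly (II) and (III). -/

namespace StableRadial
-- Convexity and parity of the nonlinearity; the transform `F`.
namespace IsNonlinearity

variable {f : ℝ → ℝ}

lemma zero (hf : IsNonlinearity f) : f 0 = 0 := by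
  have := hf.odd 0
  simp at this
  linarith

lemma differentiable (hf : IsNonlinearity f) : Differentiable ℝ f :=
  hf.contDiff_one.differentiable (by simp)

lemma continuous_deriv (hf : IsNonlinearity f) : Continuous (deriv f) :=
  hf.contDiff_one.continuous_deriv (by simp)

lemma deriv_neg (hf : IsNonlinearity f) (u : ℝ) : deriv f (-u) = deriv f u := by
  have h1 : (fun x => f (-x)) = fun x => -f x := funext hf.odd
  have h2 := deriv_comp_neg (f := f) (x := u)
  rw [h1, deriv.fun_neg] at h2
  linarith

lemma strictMonoOn_deriv (hf : IsNonlinearity f) : StrictMonoOn (deriv f) (Ici 0) :=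
  strictMonoOn_of_deriv_pos (convex_Ici 0) hf.continuous_deriv.continuousOn fun x hx =>
    hf.deriv_deriv_pos x (by simpa using hx)

lemma deriv_nonneg (hf : IsNonlinearity f) (x : ℝ) : 0 ≤ deriv f x := by
  have h : ∀ x, 0 ≤ x → 0 ≤ deriv f x := by
    have h0 : 0 ≤ deriv f 0 := by
      have h1 : Tendsto (deriv f) (𝓝[>] 0) (𝓝 (deriv f 0)) :=
        hf.continuous_deriv.continuousAt.tendsto.mono_left nhdsWithin_le_nhds
      exact ge_of_tendsto h1 (eventually_mem_nhdsWithin.mono fun x hx => (hf.deriv_pos x hx).le)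
    exact fun x hx => h0.trans (hf.strictMonoOn_deriv.monotoneOn self_mem_Ici hx hx)
  rcases le_total 0 x with hx | hx
  · exact h x hx
  · rw [← hf.deriv_neg]; exact h _ (by linarith)

lemma deriv_abs (hf : IsNonlinearity f) (x : ℝ) : deriv f |x| = deriv f x := by
  rcases abs_choice x with h | h <;> rw [h]
  exact hf.deriv_neg x

lemma deriv_le_of_abs_le (hf : IsNonlinearity f) {x M : ℝ} (h : |x| ≤ M) :
    deriv f x ≤ deriv f M := by
  rw [← hf.deriv_abs x]
  exact hf.strictMonoOn_deriv.monotoneOn (abs_nonneg x) ((abs_nonneg x).trans h) h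

lemma lipschitzOnWith (hf : IsNonlinearity f) (M : ℝ) :
    LipschitzOnWith (deriv f M).toNNReal f (Icc (-M) M) := by
  refine (convex_Icc _ _).lipschitzOnWith_of_nnnorm_deriv_le (fun x _ => hf.differentiable x) ?_
  intro x hx
  rw [← NNReal.coe_le_coe, coe_nnnorm, Real.coe_toNNReal _ (hf.deriv_nonneg M), Real.norm_eq_abs,
    abs_of_nonneg (hf.deriv_nonneg x)]
  exact hf.deriv_le_of_abs_le (abs_le.2 hx)

/-- Strict convexity on `[0,∞)`. This is what makes differences of ordered solutions strict
subsolutions of the equation linearised at the upper one. -/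
lemma sub_lt_deriv_mul (hf : IsNonlinearity f) {a b : ℝ} (ha : 0 ≤ a) (hab : a < b) :
    f b - f a < deriv f b * (b - a) := by
  obtain ⟨c, hc, h⟩ := exists_deriv_eq_slope f hab hf.differentiable.continuous.continuousOn
    hf.differentiable.differentiableOn
  have h1 : deriv f c < deriv f b :=
    hf.strictMonoOn_deriv (ha.trans hc.1.le) (ha.trans hab.le) hc.2
  have h2 : 0 < b - a := sub_pos.2 hab
  rw [eq_div_iff h2.ne'] at h
  nlinarith

lemma lt_deriv_mul (hf : IsNonlinearity f) {b : ℝ} (hb : 0 < b) : f b < deriv f b * b := by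
  simpa [hf.zero] using hf.sub_lt_deriv_mul le_rfl hb

lemma hasDerivAt_F (hf : IsNonlinearity f) {u : ℝ} (hu : 0 < u) :
    HasDerivAt (F f) (-(1 / f u)) u := by
  have hcont : ∀ s, 0 < s → ContinuousAt (fun s => 1 / f s) s := fun s hs =>
    continuousAt_const.div hf.differentiable.continuous.continuousAt (hf.pos s hs).ne'
  have hint : ∀ a b, 0 < a → 0 < b → IntervalIntegrable (fun s => 1 / f s) volume a b := by
    intro a b ha hb
    refine ContinuousOn.intervalIntegrable fun s hs => (hcont s ?_).continuousWithinAt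
    exact (lt_min ha hb).trans_le hs.1
  have h1 : HasDerivAt (fun v => ∫ s in u..v, 1 / f s) (1 / f u) u := by
    refine intervalIntegral.integral_hasDerivAt_right (hint u u hu hu) ?_ (hcont u hu)
    refine ContinuousAt.stronglyMeasurableAtFilter (s := Ioi 0) isOpen_Ioi (fun s hs => hcont s hs)
      u hu
  have h2 : F f =ᶠ[𝓝 u] fun v => F f u - ∫ s in u..v, 1 / f s := by
    filter_upwards [isOpen_Ioi.mem_nhds (show u ∈ Ioi (0 : ℝ) from hu)] with v hv
    have := intervalIntegral.integral_interval_add_Ioi' (hint u v hu hv) (hf.integrable v hv)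
    unfold F
    linarith
  exact (h1.const_sub _).congr_of_eventuallyEq h2

lemma F_pos (hf : IsNonlinearity f) {u : ℝ} (hu : 0 < u) : 0 < F f u := by
  unfold F
  rw [setIntegral_pos_iff_support_of_nonneg_ae]
  · have h : Ioi u ⊆ Function.support (fun s => 1 / f s) ∩ Ioi u := fun s hs =>
      ⟨(one_div_pos.2 (hf.pos s (hu.trans hs))).ne', hs⟩
    exact lt_of_lt_of_le (by simp) (measure_mono h)
  · exact (ae_restrict_mem measurableSet_Ioi).mono fun s hs =>
      (one_div_pos.2 (hf.pos s (hu.trans hs))).le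
  · exact hf.integrable u hu

end IsNonlinearity
end StableRadial

/-! ### Picard iteration in integrated form. -/

namespace StableRadial
open scoped NNReal BoundedContinuousFunction

/-- The weighted mean `∫₀¹ s^(N-1) h(rs) ds` of a function over the segment from `0` to `r`. -/
noncomputable def radialMean (N : ℕ) (h : ℝ → ℝ) (r : ℝ) : ℝ :=
  ∫ s in (0 : ℝ)..1, s ^ (N - 1) * h (r * s)

lemma continuous_radialMean (N : ℕ) {h : ℝ → ℝ} (hh : Continuous h) :
    Continuous (radialMean N h) := by
  unfold radialMean
  apply intervalIntegral.continuous_parametric_intervalIntegral_of_continuous'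
  fun_prop

lemma norm_radialMean_le (N : ℕ) {h : ℝ → ℝ} {r C : ℝ}
    (hC : ∀ s ∈ Icc (0 : ℝ) 1, |h (r * s)| ≤ C) : |radialMean N h r| ≤ C := by
  have := intervalIntegral.norm_integral_le_of_norm_le_const (a := (0 : ℝ)) (b := 1) (C := C)
    (f := fun s => s ^ (N - 1) * h (r * s)) (by
      intro s hs
      rw [uIoc_of_le zero_le_one] at hs
      have h1 := hC s ⟨hs.1.le, hs.2⟩
      have h2 : s ^ (N - 1) ≤ 1 := pow_le_one₀ hs.1.le hs.2
      have h3 : 0 ≤ s ^ (N - 1) := pow_nonneg hs.1.le _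
      rw [norm_mul, Real.norm_eq_abs, Real.norm_eq_abs, abs_of_nonneg h3]
      nlinarith [abs_nonneg (h (r * s))])
  simpa [radialMean] using this

lemma radialMean_sub (N : ℕ) {h k : ℝ → ℝ} (hh : Continuous h) (hk : Continuous k) (r : ℝ) :
    radialMean N h r - radialMean N k r = radialMean N (fun t => h t - k t) r := by
  unfold radialMean
  rw [← intervalIntegral.integral_sub]
  · congr 1; ext s; ring
  · exact Continuous.intervalIntegrable (by fun_prop) _ _
  · exact Continuous.intervalIntegrable (by fun_prop) _ _

lemma radialMean_zero {N : ℕ} (hN : 1 ≤ N) (h : ℝ → ℝ) : radialMean N h 0 = h 0 / N := by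
  unfold radialMean
  simp only [zero_mul]
  rw [intervalIntegral.integral_mul_const, integral_pow]
  have : ((N - 1 : ℕ) : ℝ) + 1 = N := by
    rw [Nat.cast_sub hN]; simp
  rw [this]; simp; ring

/-- The mean over `[0,1]` has no singularity at `r = 0`, while the primitive on the right is the
form that can be differentiated for `r ≠ 0`. -/
lemma pow_mul_radialMean {N : ℕ} (hN : 1 ≤ N) (h : ℝ → ℝ) (r : ℝ) :
    r ^ N * radialMean N h r = ∫ t in (0 : ℝ)..r, t ^ (N - 1) * h t := by
  have := intervalIntegral.mul_integral_comp_mul_left (f := fun t => t ^ (N - 1) * h t)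
    (a := 0) (b := 1) r
  simp only [mul_zero, mul_one] at this
  rw [← this]
  unfold radialMean
  rw [← intervalIntegral.integral_const_mul, ← intervalIntegral.integral_const_mul]
  congr 1; ext s
  rw [mul_pow]
  obtain ⟨m, rfl⟩ : ∃ m, N = m + 1 := ⟨N - 1, by omega⟩
  simp only [Nat.add_sub_cancel]; ring

lemma hasDerivAt_radialMean {N : ℕ} (hN : 1 ≤ N) {h : ℝ → ℝ} (hh : Continuous h) {r : ℝ}
    (hr : r ≠ 0) : HasDerivAt (radialMean N h) ((h r - N * radialMean N h r) / r) r := by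
  have h1 : HasDerivAt (fun r => ∫ t in (0 : ℝ)..r, t ^ (N - 1) * h t) (r ^ (N - 1) * h r) r :=
    (show Continuous fun t => t ^ (N - 1) * h t by fun_prop).integral_hasStrictDerivAt 0 r
      |>.hasDerivAt
  have h2 : HasDerivAt (fun r : ℝ => r ^ N) (N * r ^ (N - 1)) r := hasDerivAt_pow N r
  have h3 := h1.div h2 (pow_ne_zero N hr)
  have h4 : radialMean N h =ᶠ[𝓝 r]
      (fun r => ∫ t in (0 : ℝ)..r, t ^ (N - 1) * h t) / (fun r : ℝ => r ^ N) := by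
    filter_upwards [isOpen_ne.mem_nhds hr] with t ht
    have : t ^ N ≠ 0 := pow_ne_zero N ht
    simp only [Pi.div_apply]
    rw [← pow_mul_radialMean hN]; field_simp
  refine (h3.congr_of_eventuallyEq h4).congr_deriv ?_
  rw [← pow_mul_radialMean hN]
  obtain ⟨m, rfl⟩ : ∃ m, N = m + 1 := ⟨N - 1, by omega⟩
  simp only [Nat.add_sub_cancel]
  field_simp
  ring

/-- One Picard step for the radial problem, in integrated form. -/
noncomputable def picardStep (N : ℕ) (g : ℝ → ℝ) (α : ℝ) (u : ℝ → ℝ) (r : ℝ) : ℝ :=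
  α - ∫ t in (0 : ℝ)..r, t * radialMean N (fun t => g (u t)) t

lemma continuous_picardStep (N : ℕ) {g : ℝ → ℝ} (hg : Continuous g) (α : ℝ) {u : ℝ → ℝ}
    (hu : Continuous u) : Continuous (picardStep N g α u) := by
  unfold picardStep
  have h1 : Continuous fun t => t * radialMean N (fun t => g (u t)) t :=
    continuous_id.mul (continuous_radialMean N (by fun_prop))
  exact continuous_const.sub
    (intervalIntegral.continuous_primitive (fun a b => h1.intervalIntegrable a b) 0)

/-- The Gaussian weight suits the kernel `t dt`: `t exp(l t²)` has primitive `exp(l t²)/(2l)`. The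
gained factor `1/(2l)` yields the contraction. -/
lemma integral_mul_exp_sq_le {l : ℝ} (hl : 0 < l) {w : ℝ → ℝ} {C r : ℝ}
    (hC : ∀ t, |w t| ≤ C * Real.exp (l * t ^ 2)) :
    |∫ t in (0 : ℝ)..r, t * w t| ≤ C / (2 * l) * Real.exp (l * r ^ 2) := by
  have hC0 : 0 ≤ C := by
    have := (abs_nonneg _).trans (hC 0)
    simpa using this
  -- Rescaling to `[0,1]` treats both signs of `r` at once.
  have e : ∫ t in (0 : ℝ)..r, t * w t = ∫ s in (0 : ℝ)..1, r * ((r * s) * w (r * s)) := by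
    have := intervalIntegral.mul_integral_comp_mul_left (f := fun t => t * w t) (a := 0) (b := 1) r
    simp only [mul_zero, mul_one] at this
    rw [← this, intervalIntegral.integral_const_mul]
  rw [e]
  have hd : ∀ s, HasDerivAt (fun s => C / (2 * l) * Real.exp (l * (r * s) ^ 2))
      (C * r ^ 2 * s * Real.exp (l * (r * s) ^ 2)) s := by
    intro s
    have h1 : HasDerivAt (fun s => l * (r * s) ^ 2) (l * (2 * (r * s) * r)) s := by
      have h0 : HasDerivAt (fun s => r * s) r s := by
        simpa using (hasDerivAt_id s).const_mul r
      simpa using (h0.pow 2).const_mul l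
    refine (h1.exp.const_mul (C / (2 * l))).congr_deriv ?_
    field_simp
  have hc : Continuous fun s => C * r ^ 2 * s * Real.exp (l * (r * s) ^ 2) := by fun_prop
  have hi := intervalIntegral.integral_eq_sub_of_hasDerivAt (fun s _ => hd s)
    (hc.intervalIntegrable 0 1)
  have hle := intervalIntegral.norm_integral_le_of_norm_le (zero_le_one' ℝ) (μ := volume)
    (f := fun s => r * ((r * s) * w (r * s)))
    (g := fun s => C * r ^ 2 * s * Real.exp (l * (r * s) ^ 2))
    (Eventually.of_forall fun s hs => by
      have h1 := hC (r * s)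
      rw [Real.norm_eq_abs, show r * (r * s * w (r * s)) = (r ^ 2 * s) * w (r * s) by ring, abs_mul,
        abs_of_nonneg (mul_nonneg (sq_nonneg r) hs.1.le)]
      calc r ^ 2 * s * |w (r * s)| ≤ r ^ 2 * s * (C * Real.exp (l * (r * s) ^ 2)) :=
            mul_le_mul_of_nonneg_left h1 (mul_nonneg (sq_nonneg r) hs.1.le)
        _ = _ := by ring)
    (hc.intervalIntegrable 0 1)
  rw [Real.norm_eq_abs, hi] at hle
  refine hle.trans ?_
  have : 0 ≤ C / (2 * l) := by positivity
  simp
  exact this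

/-- Picard's theorem for the radial problem with a bounded Lipschitz nonlinearity, by a contraction
in the supremum norm with weight `exp (-l r²)`. -/
lemma exists_picard_fixedPoint (N : ℕ) {g : ℝ → ℝ} {L : ℝ≥0} (hg : LipschitzWith L g) {B : ℝ}
    (hB : ∀ x, |g x| ≤ B) (α : ℝ) :
    ∃ u : ℝ → ℝ, Continuous u ∧ ∀ r, u r = picardStep N g α u r := by
  have hgc := hg.continuous
  -- With this `l` the contraction factor `L/(2l)` is at most `1/2`, and `l > 0` even when `L = 0`.
  set l : ℝ := L + 1 with hl
  have hl0 : 0 < l := by positivity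
  let up : (ℝ →ᵇ ℝ) → ℝ → ℝ := fun y r => Real.exp (l * r ^ 2) * y r
  have hup : ∀ y, Continuous (up y) := fun y => by
    have := y.continuous
    fun_prop
  have hB0 : 0 ≤ B := (abs_nonneg _).trans (hB 0)
  have hbd : ∀ (y : ℝ →ᵇ ℝ) r,
      ‖Real.exp (-(l * r ^ 2)) * picardStep N g α (up y) r‖ ≤ |α| + B / (2 * l) := by
    intro y r
    have h1 := integral_mul_exp_sq_le hl0 (C := B) (r := r)
      (w := radialMean N fun t => g (up y t)) (fun t => by
        refine (norm_radialMean_le N (h := fun t => g (up y t)) (C := B)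
          fun s _ => hB _).trans ?_
        have : 1 ≤ Real.exp (l * t ^ 2) := Real.one_le_exp (by positivity)
        nlinarith)
    have h2 : 1 ≤ Real.exp (l * r ^ 2) := Real.one_le_exp (by positivity)
    rw [norm_mul, Real.norm_eq_abs, Real.norm_eq_abs, abs_of_pos (Real.exp_pos _), Real.exp_neg]
    rw [inv_mul_le_iff₀ (Real.exp_pos _)]
    have h3 : |picardStep N g α (up y) r| ≤ |α| + B / (2 * l) * Real.exp (l * r ^ 2) := by
      unfold picardStep
      exact (abs_sub _ _).trans (by gcongr)
    refine h3.trans ?_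
    nlinarith [abs_nonneg α]
  let T : (ℝ →ᵇ ℝ) → (ℝ →ᵇ ℝ) := fun y => BoundedContinuousFunction.ofNormedAddCommGroup
    (fun r => Real.exp (-(l * r ^ 2)) * picardStep N g α (up y) r)
    (by
      have := continuous_picardStep N hgc α (hup y)
      fun_prop) _ (hbd y)
  have hT : ContractingWith (1 / 2) T := by
    refine ⟨by norm_num, LipschitzWith.of_dist_le_mul fun y z => ?_⟩
    have hd0 : 0 ≤ dist y z := dist_nonneg
    rw [BoundedContinuousFunction.dist_le (by positivity)]
    intro r
    have hcy : Continuous fun t => g (up y t) := hgc.comp (hup y)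
    have hcz : Continuous fun t => g (up z t) := hgc.comp (hup z)
    have hmy := continuous_radialMean N hcy
    have hmz := continuous_radialMean N hcz
    have h1 := integral_mul_exp_sq_le hl0 (C := L * dist y z) (r := r)
      (w := fun t => radialMean N (fun t => g (up y t)) t - radialMean N (fun t => g (up z t)) t)
      (fun t => by
        rw [radialMean_sub N hcy hcz]
        refine norm_radialMean_le N fun s hs => ?_
        have h2 := hg.dist_le_mul (up y (t * s)) (up z (t * s))
        rw [Real.dist_eq] at h2
        refine h2.trans ?_
        rw [mul_assoc]
        refine mul_le_mul_of_nonneg_left ?_ L.2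
        rw [Real.dist_eq, ← mul_sub, abs_mul, abs_of_pos (Real.exp_pos _), mul_comm]
        have h3 : |y (t * s) - z (t * s)| ≤ dist y z := by
          rw [← Real.dist_eq]; exact BoundedContinuousFunction.dist_coe_le_dist _
        have h4 : (t * s) ^ 2 ≤ t ^ 2 := by
          rw [mul_pow]
          have : s ^ 2 ≤ 1 := pow_le_one₀ hs.1 hs.2
          nlinarith [sq_nonneg t]
        gcongr)
    have h5 : T y r - T z r = - (Real.exp (-(l * r ^ 2)) * ∫ t in (0 : ℝ)..r,
        t * (radialMean N (fun t => g (up y t)) t - radialMean N (fun t => g (up z t)) t)) := by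
      change Real.exp (-(l * r ^ 2)) * picardStep N g α (up y) r -
        Real.exp (-(l * r ^ 2)) * picardStep N g α (up z) r = _
      unfold picardStep
      simp_rw [mul_sub]
      rw [intervalIntegral.integral_sub]
      · ring
      · exact (continuous_id.mul hmy).intervalIntegrable _ _
      · exact (continuous_id.mul hmz).intervalIntegrable _ _
    rw [Real.dist_eq, h5, abs_neg, abs_mul, abs_of_pos (Real.exp_pos _), Real.exp_neg,
      inv_mul_le_iff₀ (Real.exp_pos _)]
    refine h1.trans ?_
    have h6 : L * dist y z / (2 * l) ≤ 1 / 2 * dist y z := by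
      rw [div_le_iff₀ (by positivity)]
      have : (L : ℝ) ≤ l := by simp [hl]
      nlinarith
    have h7 := Real.exp_pos (l * r ^ 2)
    push_cast
    nlinarith
  have hfix := hT.fixedPoint_isFixedPt
  set y := hT.fixedPoint with hy
  refine ⟨up y, hup y, fun r => ?_⟩
  have h1 : T y r = y r := by rw [hfix]
  have h2 : Real.exp (-(l * r ^ 2)) * picardStep N g α (up y) r = y r := h1
  change Real.exp (l * r ^ 2) * y r = _
  rw [← h2, ← mul_assoc, ← Real.exp_add]; simp

end StableRadial

/-! ### Global existence through the energy. -/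

namespace StableRadial
open scoped NNReal

/-- `u` solves the radial problem with nonlinearity `g` and `u 0 = α`, where `W r = -u'(r) / r` is
continuous up to `r = 0`. -/
structure IsRadialProfile (N : ℕ) (g : ℝ → ℝ) (α : ℝ) (u W : ℝ → ℝ) : Prop where
  continuous_W : Continuous W
  init : u 0 = α
  W_zero : W 0 = g α / N
  hasDerivAt : ∀ r, HasDerivAt u (-(r * W r)) r
  hasDerivAt_W : ∀ r, r ≠ 0 → HasDerivAt W ((g (u r) - N * W r) / r) r

namespace IsRadialProfile
variable {N : ℕ} {g f : ℝ → ℝ} {α : ℝ} {u W : ℝ → ℝ}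

lemma continuous (h : IsRadialProfile N g α u W) : Continuous u :=
  continuous_iff_continuousAt.2 fun r => (h.hasDerivAt r).continuousAt

/-- Profiles are defined on all of `ℝ`; reflection reduces bounds at negative `r` to positive `r`.
-/
lemma reflect (h : IsRadialProfile N g α u W) :
    IsRadialProfile N g α (fun r => u (-r)) (fun r => W (-r)) where
  continuous_W := h.continuous_W.comp continuous_neg
  init := by simpa using h.init
  W_zero := by simpa using h.W_zero
  hasDerivAt r := ((h.hasDerivAt (-r)).comp r (hasDerivAt_neg r)).congr_deriv (by ring)
  hasDerivAt_W r hr := ((h.hasDerivAt_W (-r) (neg_ne_zero.2 hr)).comp r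
    (hasDerivAt_neg r)).congr_deriv (by field_simp)

lemma hasDerivAt_flux (h : IsRadialProfile N g α u W) {r : ℝ} (hr : r ≠ 0) :
    HasDerivAt (fun r => r * W r) (g (u r) - (N - 1) * W r) r :=
  ((hasDerivAt_id r).mul (h.hasDerivAt_W r hr)).congr_deriv (by simp; field_simp; ring)

/-- The energy `u'^2/2 + ∫₀^u g` has derivative `-(N-1) r W² ≤ 0` for `r > 0`, and at `r = 0` it
equals the right-hand side because `u'(0) = 0`. -/
lemma energy_le (h : IsRadialProfile N g α u W) (hN : 1 ≤ N) (hg : Continuous g) {r : ℝ}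
    (hr : 0 ≤ r) : ∫ s in (0 : ℝ)..u r, g s ≤ ∫ s in (0 : ℝ)..α, g s := by
  set E : ℝ → ℝ := fun r => (r * W r) ^ 2 / 2 + ∫ s in (0 : ℝ)..u r, g s with hE
  have hG : ∀ x, HasDerivAt (fun x => ∫ s in (0 : ℝ)..x, g s) (g x) x := fun x =>
    (hg.integral_hasStrictDerivAt 0 x).hasDerivAt
  have hGc : Continuous fun x => ∫ s in (0 : ℝ)..x, g s :=
    continuous_iff_continuousAt.2 fun x => (hG x).continuousAt
  have hd : ∀ r, r ≠ 0 → HasDerivAt E (-((N - 1) * r * W r ^ 2)) r := by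
    intro r hr
    have h1 := ((h.hasDerivAt_flux hr).pow 2).div_const 2
    have h2 := (hG (u r)).comp r (h.hasDerivAt r)
    refine (h1.add h2).congr_deriv ?_
    simp; ring
  have hN' : (1 : ℝ) ≤ N := by exact_mod_cast hN
  have hEc : Continuous E := by
    have := h.continuous_W
    have := hGc.comp h.continuous
    simp only [Function.comp_def] at this
    fun_prop
  have hanti : AntitoneOn E (Ici 0) := by
    refine antitoneOn_of_deriv_nonpos (convex_Ici 0) hEc.continuousOn ?_ ?_
    · intro x hx
      rw [interior_Ici] at hx
      exact (hd x (ne_of_gt hx)).differentiableAt.differentiableWithinAt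
    · intro x hx
      rw [interior_Ici] at hx
      rw [(hd x (ne_of_gt hx)).deriv]
      have : 0 ≤ (N - 1 : ℝ) * x * W x ^ 2 :=
        mul_nonneg (mul_nonneg (by linarith) (le_of_lt hx)) (sq_nonneg _)
      linarith
  have := hanti self_mem_Ici hr hr
  simp only [hE, h.init] at this
  nlinarith [sq_nonneg (r * W r)]

/-- The primitive of `g` is even and exceeds its value at `α` beyond `α`, so the energy bound
confines both `u` and `-u`. -/
lemma abs_le_of_odd (h : IsRadialProfile N g α u W) (hN : 1 ≤ N) (hg : Continuous g)
    (hodd : ∀ x, g (-x) = -g x) (hpos : ∀ x, 0 < x → 0 < g x) (hα : 0 < α) (r : ℝ) :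
    |u r| ≤ α := by
  have key : ∀ x, ∫ s in (0 : ℝ)..x, g s ≤ ∫ s in (0 : ℝ)..α, g s → x ≤ α := by
    intro x hx
    by_contra! hlt
    have h1 := intervalIntegral.integral_add_adjacent_intervals
      (hg.intervalIntegrable 0 α (μ := volume)) (hg.intervalIntegrable α x)
    have h2 : 0 < ∫ s in α..x, g s :=
      intervalIntegral.intervalIntegral_pos_of_pos_on (hg.intervalIntegrable α x)
        (fun s hs => hpos s (hα.trans hs.1)) hlt
    linarith
  have heven : ∀ x, ∫ s in (0 : ℝ)..(-x), g s = ∫ s in (0 : ℝ)..x, g s := by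
    intro x
    have h1 := intervalIntegral.integral_comp_neg g (a := 0) (b := x)
    simp only [hodd, intervalIntegral.integral_neg, neg_zero] at h1
    rw [intervalIntegral.integral_symm, ← h1, neg_neg]
  have main : ∀ {u W : ℝ → ℝ}, IsRadialProfile N g α u W → ∀ r, 0 ≤ r → |u r| ≤ α := by
    intro u W h r hr
    have h1 := h.energy_le hN hg hr
    rw [abs_le']
    exact ⟨key _ h1, key _ (by rwa [heven])⟩
  rcases le_total 0 r with hr | hr
  · exact main h r hr
  · simpa using main h.reflect (-r) (by linarith)

lemma congr (h : IsRadialProfile N g α u W) (hgf : ∀ r, g (u r) = f (u r)) :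
    IsRadialProfile N f α u W where
  continuous_W := h.continuous_W
  init := h.init
  W_zero := by rw [h.W_zero, ← h.init, hgf]
  hasDerivAt := h.hasDerivAt
  hasDerivAt_W r hr := by rw [← hgf]; exact h.hasDerivAt_W r hr

end IsRadialProfile

lemma exists_isRadialProfile_of_bounded {N : ℕ} (hN : 1 ≤ N) {g : ℝ → ℝ} {L : ℝ≥0}
    (hg : LipschitzWith L g) {B : ℝ} (hB : ∀ x, |g x| ≤ B) (α : ℝ) :
    ∃ u W, IsRadialProfile N g α u W := by
  obtain ⟨u, hu, hfix⟩ := exists_picard_fixedPoint N hg hB α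
  have hc : Continuous fun t => g (u t) := hg.continuous.comp hu
  have hW := continuous_radialMean N hc
  have h0 : u 0 = α := by rw [hfix]; simp [picardStep]
  refine ⟨u, radialMean N fun t => g (u t), hW, h0, by rw [radialMean_zero hN, h0], fun r => ?_,
    fun r hr => hasDerivAt_radialMean hN hc hr⟩
  have h1 := ((continuous_id.mul hW).integral_hasStrictDerivAt 0 r).hasDerivAt.const_sub α
  exact h1.congr_of_eventuallyEq (Eventually.of_forall hfix)

/-- The radial problem has a global solution, and `|u| ≤ α`. -/
theorem exists_isRadialProfile {N : ℕ} (hN : 1 ≤ N) {f : ℝ → ℝ} (hf : IsNonlinearity f) {α : ℝ}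
    (hα : 0 < α) : ∃ u W, IsRadialProfile N f α u W ∧ ∀ r, |u r| ≤ α := by
  have hle : -α ≤ α := by linarith
  -- Clamping to `[-α, α]` makes the nonlinearity bounded and Lipschitz while keeping it odd and
  -- positive on `(0,∞)`, which is all the a priori bound needs.
  set p : ℝ → ℝ := fun x => projIcc (-α) α hle x with hp
  have hpL : LipschitzWith 1 p := by
    have := (LipschitzWith.subtype_val (Icc (-α) α)).comp (LipschitzWith.projIcc hle)
    rwa [one_mul] at this
  have hpm : ∀ x, p x ∈ Icc (-α) α := fun x => (projIcc (-α) α hle x).2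
  set g : ℝ → ℝ := fun x => f (p x) with hg
  have hgL : LipschitzWith ((deriv f α).toNNReal * 1) g := by
    rw [← lipschitzOnWith_univ]
    exact (hf.lipschitzOnWith α).comp hpL.lipschitzOnWith fun x _ => hpm x
  have hpodd : ∀ x, p (-x) = -p x := by
    intro x
    simp only [hp, coe_projIcc]
    grind
  have hodd : ∀ x, g (-x) = -g x := fun x => by rw [hg]; simp only; rw [hpodd, hf.odd]
  have hppos : ∀ x, 0 < x → 0 < p x := by
    intro x hx
    simp only [hp, coe_projIcc]
    exact lt_max_of_lt_right (lt_min hα hx)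
  obtain ⟨B, hB⟩ := isCompact_Icc.exists_bound_of_continuousOn (s := Icc (-α) α)
    hf.differentiable.continuous.continuousOn
  obtain ⟨u, W, h⟩ := exists_isRadialProfile_of_bounded hN hgL (fun x => hB _ (hpm x)) α
  have hab := h.abs_le_of_odd hN hgL.continuous hodd (fun x hx => hf.pos _ (hppos x hx)) hα
  refine ⟨u, W, h.congr fun r => ?_, hab⟩
  simp only [hg, hp]
  rw [projIcc_of_mem hle (abs_le.1 (hab r))]

end StableRadial

/-! ### Gronwall estimates: uniqueness and continuous dependence. -/

namespace StableRadial
open scoped NNReal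

/-- Gronwall's estimate for `d'' + (n / r) d' + k = 0` with `|k| ≤ L |d|`; the singular damping
term has the favourable sign. -/
lemma sq_add_sq_le_of_damped {n L T : ℝ} (hn : 0 ≤ n) (hT : 0 ≤ T) {d e k : ℝ → ℝ}
    (hd : ContinuousOn d (Icc 0 T)) (he : ContinuousOn e (Icc 0 T))
    (hd' : ∀ r ∈ Ioo 0 T, HasDerivAt d (e r) r)
    (he' : ∀ r ∈ Ioo 0 T, HasDerivAt e (-(n / r * e r) - k r) r)
    (hk : ∀ r ∈ Ioo 0 T, |k r| ≤ L * |d r|) (hL : 0 ≤ L) :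
    d T ^ 2 + e T ^ 2 ≤ Real.exp ((1 + L) * T) * (d 0 ^ 2 + e 0 ^ 2) := by
  set G : ℝ → ℝ := fun r => Real.exp (-((1 + L) * r)) * (d r ^ 2 + e r ^ 2) with hG
  have hder : ∀ r ∈ Ioo 0 T, HasDerivAt G (Real.exp (-((1 + L) * r)) *
      (-(1 + L) * (d r ^ 2 + e r ^ 2) + 2 * d r * e r + 2 * e r * (-(n / r * e r) - k r))) r := by
    intro r hr
    have h1 : HasDerivAt (fun r => -((1 + L) * r)) (-(1 + L)) r := by
      exact ((hasDerivAt_id r).const_mul (1 + L)).neg.congr_deriv (by simp)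
    refine (h1.exp.mul (((hd' r hr).pow 2).add ((he' r hr).pow 2))).congr_deriv ?_
    simp; ring
  have hanti : AntitoneOn G (Icc 0 T) := by
    refine antitoneOn_of_deriv_nonpos (convex_Icc 0 T) ?_ ?_ ?_
    · have : ContinuousOn (fun r => Real.exp (-((1 + L) * r))) (Icc 0 T) :=
        Continuous.continuousOn (by fun_prop)
      exact this.mul ((hd.pow 2).add (he.pow 2))
    · intro x hx
      rw [interior_Icc] at hx
      exact (hder x hx).differentiableAt.differentiableWithinAt
    · intro x hx
      rw [interior_Icc] at hx
      rw [(hder x hx).deriv]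
      refine mul_nonpos_of_nonneg_of_nonpos (Real.exp_pos _).le ?_
      have h1 : 0 ≤ n / x * e x ^ 2 := mul_nonneg (div_nonneg hn hx.1.le) (sq_nonneg _)
      have h2 : -(2 * e x * k x) ≤ 2 * |e x| * (L * |d x|) := by
        calc -(2 * e x * k x) ≤ |2 * e x * k x| := neg_le_abs _
          _ = 2 * |e x| * |k x| := by rw [abs_mul, abs_mul]; simp
          _ ≤ _ := mul_le_mul_of_nonneg_left (hk x hx) (by positivity)
      have h3 : 2 * |e x| * |d x| ≤ d x ^ 2 + e x ^ 2 := by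
        rw [← sq_abs (d x), ← sq_abs (e x)]; nlinarith [sq_nonneg (|d x| - |e x|)]
      have h4 : 2 * |e x| * (L * |d x|) ≤ L * (d x ^ 2 + e x ^ 2) := by
        calc 2 * |e x| * (L * |d x|) = L * (2 * |e x| * |d x|) := by ring
          _ ≤ _ := mul_le_mul_of_nonneg_left h3 hL
      nlinarith [sq_nonneg (d x - e x)]
  have h := hanti ⟨le_rfl, hT⟩ ⟨hT, le_rfl⟩ hT
  simp only [hG, mul_zero, neg_zero, Real.exp_zero, one_mul] at h
  rw [Real.exp_neg, inv_mul_le_iff₀ (Real.exp_pos _)] at h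
  exact h

namespace IsRadialProfile
variable {N : ℕ} {f : ℝ → ℝ} {α β : ℝ} {u W v V : ℝ → ℝ}

/-- The formula extends to `r = 0` because the flux and the candidate derivative are both continuous
there. -/
lemma hasDerivAt_flux' (h : IsRadialProfile N f α u W) (hf : Continuous f) (r : ℝ) :
    HasDerivAt (fun r => r * W r) (f (u r) - (N - 1) * W r) r := by
  by_cases hr : r = 0
  · subst hr
    have := h.continuous
    have := h.continuous_W
    exact hasDerivAt_of_hasDerivAt_of_ne (g := fun r => f (u r) - (N - 1) * W r)
      (fun y hy => h.hasDerivAt_flux hy)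
      (Continuous.continuousAt (by fun_prop)) (Continuous.continuousAt (by fun_prop))
  · exact h.hasDerivAt_flux hr

lemma deriv_eq (h : IsRadialProfile N f α u W) : deriv u = fun r => -(r * W r) :=
  funext fun r => (h.hasDerivAt r).deriv

lemma contDiff (h : IsRadialProfile N f α u W) (hf : Continuous f) :
    ContDiff ℝ 2 u := by
  rw [show (2 : WithTop ℕ∞) = 1 + 1 by norm_num, contDiff_succ_iff_deriv]
  refine ⟨fun r => (h.hasDerivAt r).differentiableAt, by simp, ?_⟩
  have hd := fun r => (h.hasDerivAt_flux' hf r).neg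
  rw [h.deriv_eq, contDiff_one_iff_deriv]
  refine ⟨fun r => (hd r).differentiableAt, ?_⟩
  have he : deriv (fun r => -(r * W r)) = fun r => -(f (u r) - (N - 1) * W r) :=
    funext fun r => (hd r).deriv
  rw [he]
  have := h.continuous
  have := h.continuous_W
  fun_prop

lemma isRadialSolution (h : IsRadialProfile N f α u W) (hf : Continuous f) :
    IsRadialSolution N f α u where
  contDiffOn := (h.contDiff hf).contDiffOn
  ode r hr := by
    have hd := (h.hasDerivAt_flux' hf r).neg.deriv
    have hd' : deriv (fun r => -(r * W r)) r = -(f (u r) - (N - 1) * W r) := hd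
    rw [h.deriv_eq, hd']
    field_simp
    ring
  init := h.init
  init_deriv := by simpa using (h.hasDerivAt 0).hasDerivWithinAt

lemma sub_sq_le (h : IsRadialProfile N f α u W) (k : IsRadialProfile N f β v V) (hN : 1 ≤ N)
    (hf : IsNonlinearity f) {M T : ℝ} (hT : 0 ≤ T) (hu : ∀ r, |u r| ≤ M) (hv : ∀ r, |v r| ≤ M) :
    (u T - v T) ^ 2 ≤ Real.exp ((1 + deriv f M) * T) * (α - β) ^ 2 := by
  have := h.continuous
  have := h.continuous_W
  have := k.continuous
  have := k.continuous_W
  have hN' : (1 : ℝ) ≤ N := by exact_mod_cast hN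
  have key := sq_add_sq_le_of_damped (n := N - 1) (L := deriv f M) (T := T)
    (d := fun r => u r - v r) (e := fun r => -(r * W r) - -(r * V r))
    (k := fun r => f (u r) - f (v r)) (by linarith) hT (by fun_prop) (by fun_prop)
    (fun r _ => (h.hasDerivAt r).sub (k.hasDerivAt r))
    (fun r hr => ((h.hasDerivAt_flux hr.1.ne').neg.sub
      (k.hasDerivAt_flux hr.1.ne').neg).congr_deriv (by
        have : r ≠ 0 := hr.1.ne'
        field_simp; ring))
    (fun r _ => by
      have := (hf.lipschitzOnWith M).dist_le_mul _ (abs_le.1 (hu r)) _ (abs_le.1 (hv r))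
      rwa [Real.coe_toNNReal _ (hf.deriv_nonneg M)] at this) (hf.deriv_nonneg M)
  simp only [zero_mul, neg_zero, sub_zero, h.init, k.init] at key
  nlinarith [sq_nonneg (-(T * W T) - -(T * V T))]

lemma eqOn_of_isRadialSolution (h : IsRadialProfile N f α u W) (hN : 1 ≤ N)
    (hf : IsNonlinearity f) (hv : IsRadialSolution N f α v) : EqOn v u (Ici 0) := by
  intro T hT
  have hT : 0 ≤ T := hT
  have := h.continuous
  have := h.continuous_W
  have hN' : (1 : ℝ) ≤ N := by exact_mod_cast hN
  have hsub : Icc 0 T ⊆ Ici 0 := Icc_subset_Ici_self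
  have hvc := hv.contDiffOn.continuousOn.mono hsub
  -- The competitor is only controlled on `[0,∞)`, so its derivative is taken within that set to be
  -- continuous up to `0`.
  have hv'c := (hv.contDiffOn.continuousOn_derivWithin (uniqueDiffOn_Ici 0) (by norm_num)).mono hsub
  obtain ⟨M, hM⟩ := isCompact_Icc.exists_bound_of_continuousOn hvc
  obtain ⟨M', hM'⟩ := isCompact_Icc.exists_bound_of_continuousOn
    (s := Icc 0 T) h.continuous.continuousOn
  have hmem : ∀ {x C : ℝ}, ‖x‖ ≤ C → C ≤ max M M' → x ∈ Icc (-(max M M')) (max M M') :=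
    fun hx hC => abs_le.1 (hx.trans hC)
  have hvd : ∀ r ∈ Ioo 0 T, HasDerivAt v (derivWithin v (Ici 0) r) r ∧
      HasDerivAt (derivWithin v (Ici 0)) (deriv (deriv v) r) r ∧
      derivWithin v (Ici 0) r = deriv v r := by
    intro r hr
    have hnhds : Ici (0 : ℝ) ∈ 𝓝 r := Ici_mem_nhds hr.1
    have hat : ContDiffAt ℝ 2 v r := hv.contDiffOn.contDiffAt hnhds
    have heq : derivWithin v (Ici 0) =ᶠ[𝓝 r] deriv v := by
      filter_upwards [isOpen_Ioi.mem_nhds (show r ∈ Ioi (0 : ℝ) from hr.1)] with s hs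
      exact derivWithin_of_mem_nhds (Ici_mem_nhds hs)
    refine ⟨?_, ?_, heq.eq_of_nhds⟩
    · rw [heq.eq_of_nhds]; exact (hat.differentiableAt (by norm_num)).hasDerivAt
    · have h2 : ContDiffAt ℝ 1 (deriv v) r :=
        ((hv.contDiffOn.mono Ioi_subset_Ici_self).deriv_of_isOpen isOpen_Ioi
          (by norm_num)).contDiffAt (Ioi_mem_nhds hr.1)
      exact (h2.differentiableAt (by norm_num)).hasDerivAt.congr_of_eventuallyEq heq
  have key := sq_add_sq_le_of_damped (n := N - 1) (L := deriv f (max M M')) (T := T)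
    (d := fun r => u r - v r) (e := fun r => -(r * W r) - derivWithin v (Ici 0) r)
    (k := fun r => f (u r) - f (v r)) (by linarith) hT
    (h.continuous.continuousOn.sub hvc)
    ((show Continuous fun r => -(r * W r) by fun_prop).continuousOn.sub hv'c)
    (fun r hr => (h.hasDerivAt r).sub (hvd r hr).1)
    (fun r hr => ((h.hasDerivAt_flux hr.1.ne').neg.sub (hvd r hr).2.1).congr_deriv (by
        have h0 : r ≠ 0 := hr.1.ne'
        have h1 := hv.ode r hr.1
        rw [(hvd r hr).2.2, show deriv (deriv v) r = -(((N : ℝ) - 1) / r * deriv v r) - f (v r) by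
          linarith]
        field_simp; ring))
    (fun r hr => by
      have hr' := Ioo_subset_Icc_self hr
      have := (hf.lipschitzOnWith (max M M')).dist_le_mul _ (hmem (hM' r hr') (le_max_right _ _)) _
        (hmem (hM r hr') (le_max_left _ _))
      rwa [Real.coe_toNNReal _ (hf.deriv_nonneg _)] at this) (hf.deriv_nonneg _)
  have h0 : derivWithin v (Ici 0) 0 = 0 :=
    hv.init_deriv.derivWithin (uniqueDiffOn_Ici 0 0 self_mem_Ici)
  simp only [zero_mul, neg_zero, h.init, hv.init, h0] at key
  have h1 : (u T - v T) ^ 2 = 0 := by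
    have := sq_nonneg (u T - v T)
    have := sq_nonneg (-(T * W T) - derivWithin v (Ici 0) T)
    norm_num at key
    linarith
  have h2 := pow_eq_zero_iff (two_ne_zero) |>.1 h1
  linarith

end IsRadialProfile
end StableRadial

/-! ### Radial functions on Euclidean space and their Laplacian. -/

namespace StableRadial
open scoped RealInnerProductSpace

section Radial
variable {E : Type*} [NormedAddCommGroup E] [InnerProductSpace ℝ E]

lemma hasFDerivAt_norm_of_ne_zero {x : E} (hx : x ≠ 0) :
    HasFDerivAt (fun x : E => ‖x‖) (‖x‖⁻¹ • innerSL ℝ x) x := by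
  have h1 : HasFDerivAt (fun x : E => ‖x‖ ^ 2) (2 • innerSL ℝ x) x :=
    (hasStrictFDerivAt_norm_sq x).hasFDerivAt
  have hn : ‖x‖ ≠ 0 := norm_ne_zero_iff.2 hx
  have h2 := h1.sqrt (pow_ne_zero 2 hn)
  simp only [Real.sqrt_sq (norm_nonneg _)] at h2
  convert! h2 using 1
  ext y
  simp
  field_simp

/-- Writing the derivative as `r w(r)` makes it vanish at `0`, which cancels the lack of smoothness
of the norm at the origin. -/
lemma hasFDerivAt_comp_norm {v w : ℝ → ℝ} {x : E}
    (h : HasDerivAt v (‖x‖ * w ‖x‖) ‖x‖) :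
    HasFDerivAt (fun x : E => v ‖x‖) (w ‖x‖ • innerSL ℝ x) x := by
  by_cases hx : x = 0
  · subst hx
    simp only [norm_zero, zero_mul] at h
    have h1 := hasDerivAt_iff_isLittleO_nhds_zero.1 h
    rw [hasFDerivAt_iff_isLittleO_nhds_zero]
    have h2 : Tendsto (fun x : E => ‖x‖) (𝓝 0) (𝓝 0) := by
      simpa using (continuous_norm (E := E)).tendsto 0
    have h3 := h1.comp_tendsto h2
    simp only [Function.comp_def] at h3
    simpa using h3.trans_isBigO (Asymptotics.isBigO_refl (fun x : E => x) _).norm_left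
  · refine (h.comp_hasFDerivAt x (hasFDerivAt_norm_of_ne_zero hx)).congr_fderiv ?_
    have hn : ‖x‖ ≠ 0 := norm_ne_zero_iff.2 hx
    ext y
    simp
    field_simp

lemma continuous_smul_innerSL {w : ℝ → ℝ} (hw : Continuous w) :
    Continuous fun x : E => w ‖x‖ • innerSL ℝ x := by
  have := (innerSL ℝ (E := E)).continuous
  fun_prop

lemma contDiff_one_comp_norm {v w : ℝ → ℝ} (hw : Continuous w)
    (h : ∀ r, 0 ≤ r → HasDerivAt v (r * w r) r) : ContDiff ℝ 1 (fun x : E => v ‖x‖) := by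
  have hd : ∀ x : E, HasFDerivAt (fun x : E => v ‖x‖) (w ‖x‖ • innerSL ℝ x) x := fun x =>
    hasFDerivAt_comp_norm (h _ (norm_nonneg x))
  rw [contDiff_one_iff_fderiv]
  refine ⟨fun x => (hd x).differentiableAt, ?_⟩
  rw [funext fun x => (hd x).fderiv]
  exact continuous_smul_innerSL hw

lemma norm_gradient_eq_norm_fderiv [CompleteSpace E] (φ : E → ℝ) (x : E) :
    ‖gradient φ x‖ = ‖fderiv ℝ φ x‖ := by
  simp [gradient]

/-- The derivative of `x ↦ c(|x|) ⟨y, x⟩`, including at the origin. -/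
lemma hasFDerivAt_mul_inner {c b : ℝ → ℝ} (hc : Continuous c) (y x : E)
    (h : ∀ r, 0 < r → HasDerivAt c (b r / r) r) :
    HasFDerivAt (fun x : E => c ‖x‖ * ⟪y, x⟫)
      (c ‖x‖ • innerSL ℝ y + (b ‖x‖ / ‖x‖ ^ 2 * ⟪y, x⟫) • innerSL ℝ x) x := by
  by_cases hx : x = 0
  · subst hx
    rw [hasFDerivAt_iff_isLittleO_nhds_zero]
    simp only [norm_zero, inner_zero_right, mul_zero, zero_add, map_zero, smul_zero, add_zero,
      sub_zero, smul_apply, innerSL_apply_apply, smul_eq_mul, ← sub_mul]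
    have h1 : (fun x : E => c ‖x‖ - c 0) =o[𝓝 0] (fun _ => (1 : ℝ)) := by
      rw [Asymptotics.isLittleO_one_iff]
      have : Continuous fun x : E => c ‖x‖ - c 0 := by fun_prop
      simpa using this.tendsto 0
    have h2 : (fun x : E => ⟪y, x⟫) =O[𝓝 0] fun x => ‖x‖ :=
      ((innerSL ℝ y).isBigO_id _).norm_right
    exact Asymptotics.isLittleO_norm_right.1 (by simpa using h1.mul_isBigO h2)
  · have hn : 0 < ‖x‖ := norm_pos_iff.2 hx
    have h1 : HasFDerivAt (fun x : E => c ‖x‖) ((b ‖x‖ / ‖x‖ ^ 2) • innerSL ℝ x) x :=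
      hasFDerivAt_comp_norm (w := fun r => b r / r ^ 2) ((h _ hn).congr_deriv (by field_simp))
    have h2 : HasFDerivAt (fun x : E => ⟪y, x⟫) (innerSL ℝ y) x := (innerSL ℝ y).hasFDerivAt
    refine (h1.mul h2).congr_fderiv ?_
    ext z
    simp
    ring

lemma continuous_fderiv_mul_inner {c b : ℝ → ℝ} (hc : Continuous c) (hb : Continuous b)
    (hb0 : b 0 = 0) (y : E) :
    Continuous fun x : E =>
      c ‖x‖ • innerSL ℝ y + (b ‖x‖ / ‖x‖ ^ 2 * ⟪y, x⟫) • innerSL ℝ x := by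
  have hi := (innerSL ℝ (E := E)).continuous
  refine Continuous.add (by fun_prop) (continuous_iff_continuousAt.2 fun x => ?_)
  by_cases hx : x = 0
  · subst hx
    rw [ContinuousAt, map_zero, smul_zero]
    refine squeeze_zero_norm (a := fun x : E => |b ‖x‖| * ‖y‖) (fun x => ?_) ?_
    · rw [norm_smul, norm_mul, norm_div, innerSL_apply_norm]
      by_cases hx : x = 0
      · subst hx; simp [hb0]
      have hn : 0 < ‖x‖ := norm_pos_iff.2 hx
      have h1 : ‖⟪y, x⟫‖ ≤ ‖y‖ * ‖x‖ := norm_inner_le_norm y x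
      calc ‖b ‖x‖‖ / ‖‖x‖ ^ 2‖ * ‖⟪y, x⟫‖ * ‖x‖
          ≤ ‖b ‖x‖‖ / ‖‖x‖ ^ 2‖ * (‖y‖ * ‖x‖) * ‖x‖ := by gcongr
        _ = |b ‖x‖| * ‖y‖ := by
          rw [Real.norm_eq_abs, Real.norm_of_nonneg (sq_nonneg _)]; field_simp
    · have : Continuous fun x : E => |b ‖x‖| * ‖y‖ := by fun_prop
      simpa [hb0] using this.tendsto 0
  · have hn : ‖x‖ ≠ 0 := norm_ne_zero_iff.2 hx
    have : ContinuousAt (fun x : E => b ‖x‖ / ‖x‖ ^ 2) x :=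
      ContinuousAt.div (by fun_prop) (by fun_prop) (pow_ne_zero 2 hn)
    have h2 : ContinuousAt (fun x : E => ⟪y, x⟫) x := by fun_prop
    exact (this.mul h2).smul hi.continuousAt

end Radial

/-- The gradient is `-W(|x|) x`. The trace of its derivative is `-N W - (f(u) - N W) = -f(u)`. The
identity `W 0 = f α / N` is what makes the second derivatives continuous at the origin. -/
lemma IsRadialProfile.isEntireSolution {N : ℕ} {f : ℝ → ℝ} {α : ℝ} {u W : ℝ → ℝ}
    (h : IsRadialProfile N f α u W) (hN : 1 ≤ N) (hf : Continuous f) :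
    IsEntireSolution N f (radial N u) := by
  have hN0 : (N : ℝ) ≠ 0 := by positivity
  set E := EuclideanSpace ℝ (Fin N)
  have hW := h.continuous_W
  have hu := h.continuous
  have hU : ∀ x : E, HasFDerivAt (radial N u) (-W ‖x‖ • innerSL ℝ x) x := fun x =>
    hasFDerivAt_comp_norm (w := fun r => -W r) ((h.hasDerivAt _).congr_deriv (by ring))
  have hfd : ∀ y x : E, fderiv ℝ (radial N u) x y = -W ‖x‖ * ⟪y, x⟫ := fun y x => by
    rw [(hU x).fderiv]; simp [real_inner_comm]
  have hG : ∀ y x : E, HasFDerivAt (fun x => fderiv ℝ (radial N u) x y)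
      (-W ‖x‖ • innerSL ℝ y +
        (-(f (u ‖x‖) - N * W ‖x‖) / ‖x‖ ^ 2 * ⟪y, x⟫) • innerSL ℝ x) x := fun y x => by
    rw [funext fun x => hfd y x]
    exact hasFDerivAt_mul_inner (c := fun r => -W r) (b := fun r => -(f (u r) - N * W r))
      hW.neg y x fun r hr => (h.hasDerivAt_W r hr.ne').neg.congr_deriv (by ring)
  have h2 : ContDiff ℝ 2 (radial N u) := by
    rw [show (2 : WithTop ℕ∞) = 1 + 1 by norm_num, contDiff_succ_iff_fderiv_apply]
    refine ⟨fun x => (hU x).differentiableAt, by simp, fun y => ?_⟩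
    rw [contDiff_one_iff_fderiv]
    refine ⟨fun x => (hG y x).differentiableAt, ?_⟩
    rw [funext fun x => (hG y x).fderiv]
    exact continuous_fderiv_mul_inner (c := fun r => -W r) (b := fun r => -(f (u r) - N * W r))
      hW.neg (by fun_prop) (by rw [h.init, h.W_zero]; field_simp; ring) y
  refine ⟨h2, fun x => ?_⟩
  have hd : DifferentiableAt ℝ (fderiv ℝ (radial N u)) x :=
    (h2.fderiv_right (m := 1) (by norm_num)).differentiable (by norm_num) x
  set e := EuclideanSpace.basisFun (Fin N) ℝ
  have hterm : ∀ i, iteratedFDeriv ℝ 2 (radial N u) x ![e i, e i] =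
      -W ‖x‖ + -(f (u ‖x‖) - N * W ‖x‖) / ‖x‖ ^ 2 * x i ^ 2 := by
    intro i
    have h3 := (hd.hasFDerivAt.clm_apply (hasFDerivAt_const (e i) x)).unique (hG (e i) x)
    have h4 := congrArg (fun l => l (e i)) h3
    rw [iteratedFDeriv_two_apply]
    simp only [Matrix.cons_val_zero, Matrix.cons_val_one]
    simp at h4
    rw [h4]
    have h5 : ⟪e i, x⟫ = x i := by rw [← e.repr_apply_apply]; rfl
    rw [real_inner_comm (e i) x, h5]
    ring
  rw [InnerProductSpace.laplacian_eq_iteratedFDeriv_orthonormalBasis _ e]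
  simp only [hterm, Finset.sum_add_distrib, ← Finset.mul_sum]
  have hs : ∑ i, x i ^ 2 = ‖x‖ ^ 2 := by
    rw [EuclideanSpace.norm_sq_eq]; simp
  rw [hs]
  simp only [Finset.sum_const, Finset.card_univ, Fintype.card_fin, nsmul_eq_mul, radial]
  by_cases hx : x = 0
  · subst hx; simp [h.init, h.W_zero]; field_simp; ring
  · have hn : ‖x‖ ≠ 0 := norm_ne_zero_iff.2 hx
    field_simp; ring

end StableRadial

/-! ### Divergence theorem and Hardy's inequality. -/

namespace StableRadial
open scoped RealInnerProductSpace

/-- The divergence theorem for the vector field `x ↦ g(x) x`. -/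
lemma integral_fderiv_apply_self {N : ℕ} {g : EuclideanSpace ℝ (Fin N) → ℝ} (hg : ContDiff ℝ 1 g)
    (hs : HasCompactSupport g) : ∫ x, fderiv ℝ g x x = -(N * ∫ x, g x) := by
  have hgc := hg.continuous
  have hg' : Continuous (fderiv ℝ g) := hg.continuous_fderiv (by norm_num)
  have hs' : HasCompactSupport (fderiv ℝ g) := hs.fderiv ℝ
  have hgd : Differentiable ℝ g := hg.differentiable (by norm_num)
  let p : Fin N → EuclideanSpace ℝ (Fin N) →L[ℝ] ℝ := fun i => EuclideanSpace.proj i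
  let e : Fin N → EuclideanSpace ℝ (Fin N) := fun i => EuclideanSpace.single i 1
  have hint : ∀ i, Integrable fun x => p i x * fderiv ℝ g x (e i) := fun i => by
    refine Continuous.integrable_of_hasCompactSupport (by fun_prop) ?_
    exact (hs'.comp_left (g := fun l : EuclideanSpace ℝ (Fin N) →L[ℝ] ℝ => l (e i)) (by simp)).mul_left
  have hibp : ∀ i, ∫ x, p i x * fderiv ℝ g x (e i) = -∫ x, g x := by
    intro i
    have h1 : ∀ x, fderiv ℝ (p i) x (e i) = 1 := fun x => by
      rw [(p i).fderiv]; simp [p, e]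
    have h2 := integral_mul_fderiv_eq_neg_fderiv_mul_of_integrable (μ := volume) (f := p i) (g := g)
      (v := e i) ?_ (hint i) ?_ (fun x _ => (p i).differentiableAt) (fun x _ => hgd x)
    · simpa only [h1, one_mul] using h2
    · simp only [h1, one_mul]
      exact hgc.integrable_of_hasCompactSupport hs
    · exact Continuous.integrable_of_hasCompactSupport (by fun_prop) hs.mul_left
  have hx : ∀ x : EuclideanSpace ℝ (Fin N), fderiv ℝ g x x = ∑ i, p i x * fderiv ℝ g x (e i) := by
    intro x
    have := congrArg (fderiv ℝ g x) ((EuclideanSpace.basisFun (Fin N) ℝ).sum_repr x)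
    rw [← this]
    simp [p, e]
  simp_rw [hx]
  rw [integral_finsetSum _ fun i _ => hint i]
  simp [hibp]

lemma integrable_gradient_sq_sub {N : ℕ} {φ V : EuclideanSpace ℝ (Fin N) → ℝ}
    (hφ : ContDiff ℝ 1 φ) (hs : HasCompactSupport φ) (hV : Continuous V) :
    Integrable (fun x => ‖gradient φ x‖ ^ 2) ∧ Integrable (fun x => V x * φ x ^ 2) := by
  have hφc := hφ.continuous
  have hφ' : Continuous (fderiv ℝ φ) := hφ.continuous_fderiv (by norm_num)
  constructor
  · simp only [norm_gradient_eq_norm_fderiv]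
    refine Continuous.integrable_of_hasCompactSupport (by fun_prop) ?_
    exact (hs.fderiv ℝ).comp_left (g := fun l => ‖l‖ ^ 2) (by simp)
  · refine Continuous.integrable_of_hasCompactSupport (by fun_prop) ?_
    exact (hs.comp_left (g := fun t => t ^ 2) (by norm_num)).mul_left

/-- Hardy's inequality, with the singular weight regularised. -/
theorem hardy_inequality {N : ℕ} (hN : 2 ≤ N) {φ : EuclideanSpace ℝ (Fin N) → ℝ}
    (hφ : ContDiff ℝ 1 φ) (hs : HasCompactSupport φ) {ε : ℝ} (hε : 0 < ε) :
    ∫ x, (((N : ℝ) - 2) / 2) ^ 2 / (‖x‖ ^ 2 + ε) * φ x ^ 2 ≤ ∫ x, ‖gradient φ x‖ ^ 2 := by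
  set k : ℝ := ((N : ℝ) - 2) / 2 with hk
  have hk0 : 0 ≤ k := by
    have : (2 : ℝ) ≤ N := by exact_mod_cast hN
    rw [hk]; linarith
  have hNk : (N : ℝ) = 2 * k + 2 := by rw [hk]; ring
  have hφc := hφ.continuous
  have hφ' : Continuous (fderiv ℝ φ) := hφ.continuous_fderiv (by norm_num)
  have hφd : Differentiable ℝ φ := hφ.differentiable (by norm_num)
  have hq : ∀ x : EuclideanSpace ℝ (Fin N), 0 < ‖x‖ ^ 2 + ε := fun x => by positivity
  set ρ : EuclideanSpace ℝ (Fin N) → ℝ := fun x => (‖x‖ ^ 2 + ε)⁻¹ with hρ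
  have hρd : ∀ x, HasFDerivAt ρ (-((‖x‖ ^ 2 + ε) ^ 2)⁻¹ • (2 • innerSL ℝ x)) x := by
    intro x
    have h1 : HasFDerivAt (fun x : EuclideanSpace ℝ (Fin N) => ‖x‖ ^ 2 + ε) (2 • innerSL ℝ x) x :=
      (hasStrictFDerivAt_norm_sq x).hasFDerivAt.add_const ε
    exact (hasDerivAt_inv (hq x).ne').comp_hasFDerivAt x h1
  have hρ1 : ContDiff ℝ 1 ρ :=
    ContDiff.inv ((contDiff_norm_sq ℝ).add contDiff_const) fun x => (hq x).ne'
  have hρc := hρ1.continuous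
  have hg1 : ContDiff ℝ 1 fun x => φ x ^ 2 * ρ x := (hφ.pow 2).mul hρ1
  have hs2 : HasCompactSupport fun x => φ x ^ 2 :=
    hs.comp_left (g := fun t => t ^ 2) (by norm_num)
  have hgs : HasCompactSupport fun x => φ x ^ 2 * ρ x := hs2.mul_right
  have hdiv := integral_fderiv_apply_self hg1 hgs
  have hgd : ∀ x, fderiv ℝ (fun x => φ x ^ 2 * ρ x) x x =
      2 * φ x * ρ x * fderiv ℝ φ x x - 2 * φ x ^ 2 * ρ x ^ 2 * ‖x‖ ^ 2 := by
    intro x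
    have h1 := (((hφd x).hasFDerivAt.pow 2).mul (hρd x)).fderiv
    have h2 : fderiv ℝ (fun x => φ x ^ 2 * ρ x) x = _ := h1
    rw [h2]
    simp only [hρ, add_apply, smul_apply, innerSL_apply_apply, real_inner_self_eq_norm_sq,
      smul_eq_mul, nsmul_eq_mul]
    have := (hq x).ne'
    push_cast
    field_simp
    ring
  rw [← sub_nonneg]
  obtain ⟨hI1, hI2⟩ := integrable_gradient_sq_sub hφ hs
    (V := fun x => k ^ 2 / (‖x‖ ^ 2 + ε))
    (continuous_const.div (by fun_prop) fun x => (hq x).ne')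
  have hI3 : Integrable fun x => φ x ^ 2 * ρ x :=
    Continuous.integrable_of_hasCompactSupport (by fun_prop) hgs
  have hI4 : Integrable fun x => fderiv ℝ (fun x => φ x ^ 2 * ρ x) x x := by
    have : Continuous (fderiv ℝ fun x => φ x ^ 2 * ρ x) := hg1.continuous_fderiv (by norm_num)
    refine Continuous.integrable_of_hasCompactSupport (by fun_prop) ?_
    refine (hgs.fderiv ℝ).mono fun x hx h0 => hx ?_
    simp [h0]
  -- With `k = (N-2)/2`, the expression equals `|∇φ + kρφx|² + (k² + 2k)φ²ρ(1 - ρ|x|²)`, and `ρ|x|²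
  -- ≤ 1`. The added term is `k` times the divergence of `φ²ρ x`, so it integrates to zero.
  have hpt : ∀ x, 0 ≤ (‖gradient φ x‖ ^ 2 - k ^ 2 / (‖x‖ ^ 2 + ε) * φ x ^ 2) +
      k * (fderiv ℝ (fun x => φ x ^ 2 * ρ x) x x + N * (φ x ^ 2 * ρ x)) := by
    intro x
    rw [hgd, norm_gradient_eq_norm_fderiv, div_eq_mul_inv, hNk]
    change 0 ≤ (‖fderiv ℝ φ x‖ ^ 2 - k ^ 2 * ρ x * φ x ^ 2) + k *
      (2 * φ x * ρ x * fderiv ℝ φ x x - 2 * φ x ^ 2 * ρ x ^ 2 * ‖x‖ ^ 2 +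
        (2 * k + 2) * (φ x ^ 2 * ρ x))
    have hρ0 : 0 < ρ x := inv_pos.2 (hq x)
    have h1 : ρ x * ‖x‖ ^ 2 ≤ 1 := by
      rw [hρ, inv_mul_le_iff₀ (hq x)]; linarith
    have h2 : |fderiv ℝ φ x x| ≤ ‖fderiv ℝ φ x‖ * ‖x‖ := (fderiv ℝ φ x).le_opNorm x
    have h3 : -(‖fderiv ℝ φ x‖ * ‖x‖ * |k * φ x * ρ x|) ≤ k * φ x * ρ x * fderiv ℝ φ x x := by
      have h4 := neg_abs_le (k * φ x * ρ x * fderiv ℝ φ x x)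
      rw [abs_mul] at h4
      nlinarith [abs_nonneg (k * φ x * ρ x)]
    have h5 : 0 ≤ (‖fderiv ℝ φ x‖ - ‖x‖ * |k * φ x * ρ x|) ^ 2 := sq_nonneg _
    have h6 : (‖x‖ * |k * φ x * ρ x|) ^ 2 = k ^ 2 * φ x ^ 2 * ρ x * (ρ x * ‖x‖ ^ 2) := by
      rw [mul_pow, sq_abs]; ring
    have h7 : 0 ≤ (k ^ 2 + 2 * k) * φ x ^ 2 * ρ x * (1 - ρ x * ‖x‖ ^ 2) :=
      mul_nonneg (by positivity) (by linarith)
    nlinarith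
  have hfin := integral_nonneg_of_ae (μ := volume) (Eventually.of_forall hpt)
  have hA : Integrable fun x => ‖gradient φ x‖ ^ 2 - k ^ 2 / (‖x‖ ^ 2 + ε) * φ x ^ 2 :=
    hI1.sub hI2
  have hB : Integrable fun x =>
      fderiv ℝ (fun x => φ x ^ 2 * ρ x) x x + N * (φ x ^ 2 * ρ x) := hI4.add (hI3.const_mul _)
  rw [integral_add hA (hB.const_mul k), integral_const_mul, integral_add hI4 (hI3.const_mul _),
    integral_const_mul, hdiv, integral_sub hI1 hI2] at hfin
  linarith

lemma integral_nonneg_of_le_hardy {N : ℕ} (hN : 2 ≤ N) {φ V : EuclideanSpace ℝ (Fin N) → ℝ}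
    (hφ : ContDiff ℝ 1 φ) (hs : HasCompactSupport φ) (hV : Continuous V) {ε : ℝ} (hε : 0 < ε)
    (hle : ∀ x, φ x ≠ 0 → V x ≤ (((N : ℝ) - 2) / 2) ^ 2 / (‖x‖ ^ 2 + ε)) :
    0 ≤ ∫ x, (‖gradient φ x‖ ^ 2 - V x * φ x ^ 2) := by
  obtain ⟨h1, h2⟩ := integrable_gradient_sq_sub hφ hs hV
  have hc : Continuous fun x : EuclideanSpace ℝ (Fin N) =>
      (((N : ℝ) - 2) / 2) ^ 2 / (‖x‖ ^ 2 + ε) :=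
    continuous_const.div (by fun_prop) fun x => by positivity
  rw [integral_sub h1 h2, sub_nonneg]
  refine le_trans (integral_mono h2 (integrable_gradient_sq_sub hφ hs hc).2 fun x => ?_)
    (hardy_inequality hN hφ hs hε)
  by_cases hx : φ x = 0
  · simp [hx]
  · exact mul_le_mul_of_nonneg_right (hle x hx) (sq_nonneg _)

end StableRadial

/-! ### Radial test functions of negative energy. -/

namespace StableRadial
open scoped RealInnerProductSpace

/-- The integral of the energy density of a radial function is a one-dimensional integral. -/
lemma integral_gradient_sq_sub_radial_neg {N : ℕ} (hN : 1 ≤ N) {ψ w V : ℝ → ℝ} {R : ℝ}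
    (hR : 0 < R) (h : ∀ r, HasDerivAt ψ (r * w r) r) (hψ : ∀ r, R < r → ψ r = 0)
    (hw : ∀ r, R < r → w r = 0)
    (hneg : ∫ r in (0 : ℝ)..R, r ^ (N - 1) * ((r * w r) ^ 2 - V r * ψ r ^ 2) < 0) :
    ∫ x : EuclideanSpace ℝ (Fin N),
      (‖gradient (fun x => ψ ‖x‖) x‖ ^ 2 - V ‖x‖ * ψ ‖x‖ ^ 2) < 0 := by
  have hgrad : ∀ x : EuclideanSpace ℝ (Fin N),
      ‖gradient (fun x => ψ ‖x‖) x‖ ^ 2 = (‖x‖ * w ‖x‖) ^ 2 := by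
    intro x
    rw [norm_gradient_eq_norm_fderiv, (hasFDerivAt_comp_norm (h ‖x‖)).fderiv, norm_smul,
      innerSL_apply_norm, mul_pow, mul_pow, Real.norm_eq_abs, sq_abs, mul_comm]
  simp only [hgrad]
  have : Nonempty (Fin N) := ⟨⟨0, hN⟩⟩
  rw [integral_fun_norm_addHaar volume fun r => (r * w r) ^ 2 - V r * ψ r ^ 2]
  rw [finrank_euclideanSpace_fin]
  have h1 : ∫ y in Ioi (0 : ℝ), y ^ (N - 1) • ((y * w y) ^ 2 - V y * ψ y ^ 2) =
      ∫ r in (0 : ℝ)..R, r ^ (N - 1) * ((r * w r) ^ 2 - V r * ψ r ^ 2) := by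
    rw [intervalIntegral.integral_of_le hR.le]
    refine setIntegral_eq_of_subset_of_forall_sdiff_eq_zero measurableSet_Ioi
      Ioc_subset_Ioi_self fun r hr => ?_
    have hr' : R < r := by
      by_contra! hle
      exact hr.2 ⟨hr.1, hle⟩
    simp [hψ r hr', hw r hr']
  rw [h1, nsmul_eq_mul, smul_eq_mul]
  have h2 : 0 < (volume : Measure (EuclideanSpace ℝ (Fin N))).real (Metric.ball 0 1) :=
    ENNReal.toReal_pos (Metric.measure_ball_pos volume _ one_pos).ne' measure_ball_lt_top.ne
  have h3 : (0 : ℝ) < N := by exact_mod_cast hN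
  exact mul_neg_of_pos_of_neg h3 (mul_neg_of_pos_of_neg h2 hneg)

/-- A radial function that is positive in a ball, vanishes on its boundary and satisfies
`-Δz < V z` there gives a test function with negative energy, namely `z - δ arctan (z / δ)`. -/
theorem exists_test_function_neg {N : ℕ} (hN : 2 ≤ N) {z Z k V : ℝ → ℝ} {R : ℝ} (hR : 0 < R)
    (hZ : Continuous Z) (hz : ∀ r, HasDerivAt z (-(r * Z r)) r)
    (hflux : ∀ r, HasDerivAt (fun r => r * Z r) (k r - (N - 1) * Z r) r)
    (hk : Continuous k) (hV : Continuous V) (hV0 : ∀ r, 0 ≤ V r)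
    (hpos : ∀ r ∈ Ico 0 R, 0 < z r) (hzR : z R = 0)
    (hlt : ∀ r ∈ Ioo 0 R, k r < V r * z r) :
    ∃ φ : EuclideanSpace ℝ (Fin N) → ℝ, ContDiff ℝ 1 φ ∧ HasCompactSupport φ ∧
      (∀ x, φ x ≠ 0 → ‖x‖ < R) ∧ ∫ x, (‖gradient φ x‖ ^ 2 - V ‖x‖ * φ x ^ 2) < 0 := by
  have hzc : Continuous z := continuous_iff_continuousAt.2 fun r => (hz r).continuousAt
  set I : ℝ := ∫ r in (0 : ℝ)..R, r ^ (N - 1) * ((r * Z r) ^ 2 - V r * z r ^ 2) with hI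
  -- Integration by parts turns `I` into `-∫ r^(N-1) (V z - k) z`; the boundary terms vanish at `0`
  -- and, since `z R = 0`, at `R`.
  have hI0 : I < 0 := by
    have hA : ∀ r, HasDerivAt (fun r => -(r ^ (N - 1) * (r * Z r) * z r))
        (r ^ (N - 1) * ((r * Z r) ^ 2 - k r * z r)) r := by
      intro r
      refine (((hasDerivAt_pow (N - 1) r).mul (hflux r)).mul (hz r)).neg.congr_deriv ?_
      obtain ⟨m, rfl⟩ : ∃ m, N = m + 2 := ⟨N - 2, by omega⟩
      simp only [show m + 2 - 1 = m + 1 by omega, show m + 1 - 1 = m by omega]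
      push_cast
      simp only [Pi.mul_apply]
      ring
    have hAi := intervalIntegral.integral_eq_sub_of_hasDerivAt (a := 0) (b := R)
      (fun r _ => hA r) (Continuous.intervalIntegrable (by fun_prop) _ _)
    simp only [hzR, mul_zero, zero_mul, neg_zero, sub_zero] at hAi
    have hpos' : 0 < ∫ r in (0 : ℝ)..R, r ^ (N - 1) * ((V r * z r - k r) * z r) :=
      intervalIntegral.intervalIntegral_pos_of_pos_on
        (Continuous.intervalIntegrable (by fun_prop) _ _) (fun r hr => by
          have := hpos r (Ioo_subset_Ico_self hr)
          have := hlt r hr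
          exact mul_pos (pow_pos hr.1 _) (mul_pos (by linarith) ‹_›)) hR
    have : I = (∫ r in (0 : ℝ)..R, r ^ (N - 1) * ((r * Z r) ^ 2 - k r * z r)) -
        ∫ r in (0 : ℝ)..R, r ^ (N - 1) * ((V r * z r - k r) * z r) := by
      rw [hI, ← intervalIntegral.integral_sub]
      · refine intervalIntegral.integral_congr fun r _ => ?_
        ring
      · exact Continuous.intervalIntegrable (by fun_prop) _ _
      · exact Continuous.intervalIntegrable (by fun_prop) _ _
    linarith
  set J : ℝ := ∫ r in (0 : ℝ)..R, r ^ (N - 1) * (V r * (Real.pi * z r)) with hJ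
  have hzn : ∀ r ∈ Icc 0 R, 0 ≤ z r := by
    intro r hr
    rcases hr.2.lt_or_eq with h | h
    · exact (hpos r ⟨hr.1, h⟩).le
    · rw [h, hzR]
  have hJ0 : 0 ≤ J := intervalIntegral.integral_nonneg hR.le fun r hr =>
    mul_nonneg (pow_nonneg hr.1 _)
      (mul_nonneg (hV0 r) (mul_nonneg Real.pi_pos.le (hzn r hr)))
  -- Smoothing costs at most `δ J`, and this `δ` gives `I + δ J = I / (J + 1) < 0`.
  set δ : ℝ := -I / (J + 1) with hδ
  have hδ0 : 0 < δ := div_pos (by linarith) (by linarith)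
  -- Both `g` and `g'` vanish at `0`, so `g ∘ z` extended by zero beyond `R` is `C¹`, which `z`
  -- itself need not be. Moreover `|g'| ≤ 1` and `g` loses little of `t²`.
  set g : ℝ → ℝ := fun t => t - δ * Real.arctan (t / δ) with hg
  set g' : ℝ → ℝ := fun t => 1 - 1 / (1 + (t / δ) ^ 2) with hg'
  have hgd : ∀ t, HasDerivAt g (g' t) t := by
    intro t
    refine ((hasDerivAt_id t).sub
      ((((hasDerivAt_id t).div_const δ).arctan).const_mul δ)).congr_deriv ?_
    simp only [hg', id]
    field_simp
  have hg'c : Continuous g' :=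
    continuous_const.sub (continuous_const.div (by fun_prop) fun t => by positivity)
  have hgc : Continuous g := continuous_iff_continuousAt.2 fun t => (hgd t).continuousAt
  have hg0 : g 0 = 0 := by simp [hg]
  have hg'0 : g' 0 = 0 := by simp [hg']
  have hg'le : ∀ t, g' t ^ 2 ≤ 1 := by
    intro t
    have h1 : 0 < 1 / (1 + (t / δ) ^ 2) := by positivity
    have h2 : 1 / (1 + (t / δ) ^ 2) ≤ 1 := by
      rw [div_le_one (by positivity)]; nlinarith [sq_nonneg (t / δ)]
    simp only [hg']
    nlinarith
  have hgle : ∀ t, 0 ≤ t → t ^ 2 - δ * (Real.pi * t) ≤ g t ^ 2 := by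
    intro t ht
    have h1 : 0 ≤ Real.arctan (t / δ) := Real.arctan_nonneg.2 (div_nonneg ht hδ0.le)
    have h2 : Real.arctan (t / δ) ≤ Real.pi / 2 := (Real.arctan_lt_pi_div_two _).le
    have h3 : δ * Real.arctan (t / δ) * t ≤ δ * (Real.pi / 2) * t := by gcongr
    simp only [hg]
    nlinarith [sq_nonneg (δ * Real.arctan (t / δ))]
  set ψ : ℝ → ℝ := fun r => if r ≤ R then g (z r) else 0 with hψ
  set w : ℝ → ℝ := fun r => if r ≤ R then -(g' (z r) * Z r) else 0 with hw
  have hwc : Continuous w :=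
    Continuous.if_le (by fun_prop) (by fun_prop) continuous_id continuous_const
      (fun r hr => by change r = R at hr; rw [hr, hzR, hg'0]; simp)
  have hψc : Continuous ψ :=
    Continuous.if_le (by fun_prop) (by fun_prop) continuous_id continuous_const
      (fun r hr => by change r = R at hr; rw [hr, hzR, hg0])
  have hψd : ∀ r, HasDerivAt ψ (r * w r) r := by
    refine hasDerivAt_of_hasDerivAt_of_ne' (g := fun r => r * w r) (x := R) (fun r hr => ?_)
      hψc.continuousAt (Continuous.continuousAt (by fun_prop))
    rcases hr.lt_or_gt with h | h
    · have h1 : HasDerivAt (fun r => g (z r)) (r * w r) r := by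
        refine ((hgd (z r)).comp r (hz r)).congr_deriv ?_
        simp only [hw, if_pos h.le]; ring
      refine h1.congr_of_eventuallyEq ?_
      filter_upwards [Iio_mem_nhds h] with s hs
      simp only [hψ, if_pos (le_of_lt (mem_Iio.1 hs))]
    · have h1 : HasDerivAt (fun _ : ℝ => (0 : ℝ)) (r * w r) r := by
        refine (hasDerivAt_const r 0).congr_deriv ?_
        simp only [hw, if_neg h.not_ge, mul_zero]
      refine h1.congr_of_eventuallyEq ?_
      filter_upwards [Ioi_mem_nhds h] with s hs
      simp only [hψ, if_neg (not_le.2 (mem_Ioi.1 hs))]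
  have hsupp : ∀ x : EuclideanSpace ℝ (Fin N), ψ ‖x‖ ≠ 0 → ‖x‖ < R := by
    intro x hx
    by_contra! hle
    apply hx
    rcases hle.eq_or_lt with h | h
    · simp [hψ, ← h, hzR, hg0]
    · simp [hψ, h.not_ge]
  refine ⟨fun x => ψ ‖x‖, contDiff_one_comp_norm hwc fun r _ => hψd r, ?_, hsupp, ?_⟩
  · refine HasCompactSupport.of_support_subset_isCompact (isCompact_closedBall 0 R) fun x hx => ?_
    simpa using (hsupp x hx).le
  refine integral_gradient_sq_sub_radial_neg (by omega) hR hψd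
    (fun r hr => by simp [hψ, hr.not_ge]) (fun r hr => by simp [hw, hr.not_ge]) ?_
  have hle : ∫ r in (0 : ℝ)..R, r ^ (N - 1) * ((r * w r) ^ 2 - V r * ψ r ^ 2) ≤
      ∫ r in (0 : ℝ)..R, (r ^ (N - 1) * ((r * Z r) ^ 2 - V r * z r ^ 2) +
        δ * (r ^ (N - 1) * (V r * (Real.pi * z r)))) := by
    refine intervalIntegral.integral_mono_on hR.le
      (Continuous.intervalIntegrable (by fun_prop) _ _)
      (Continuous.intervalIntegrable (by fun_prop) _ _) fun r hr => ?_
    simp only [hψ, hw, if_pos hr.2]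
    have h1 : (r * -(g' (z r) * Z r)) ^ 2 ≤ (r * Z r) ^ 2 := by
      have : (r * -(g' (z r) * Z r)) ^ 2 = g' (z r) ^ 2 * (r * Z r) ^ 2 := by ring
      rw [this]
      exact mul_le_of_le_one_left (sq_nonneg _) (hg'le _)
    have h2 := mul_le_mul_of_nonneg_left (hgle (z r) (hzn r hr)) (hV0 r)
    calc r ^ (N - 1) * ((r * -(g' (z r) * Z r)) ^ 2 - V r * g (z r) ^ 2)
        ≤ r ^ (N - 1) * ((r * Z r) ^ 2 - V r * z r ^ 2 + δ * (V r * (Real.pi * z r))) :=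
          mul_le_mul_of_nonneg_left (by linarith) (pow_nonneg hr.1 _)
      _ = _ := by ring
  rw [intervalIntegral.integral_add (Continuous.intervalIntegrable (by fun_prop) _ _)
    (Continuous.intervalIntegrable (by fun_prop) _ _), intervalIntegral.integral_const_mul] at hle
  have hfin : I + δ * J < 0 := by
    have : I + δ * J = I / (J + 1) := by
      rw [hδ]; field_simp; ring
    rw [this]
    exact div_neg_of_neg_of_pos hI0 (by linarith)
  exact hle.trans_lt hfin

end StableRadial

/-! ### The Joseph-Lundgren barrier and stability for small `α`. -/

namespace StableRadial

lemma exists_first_zero {g : ℝ → ℝ} {r : ℝ} (hr : 0 ≤ r) (hg : ContinuousOn g (Icc 0 r))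
    (h0 : 0 < g 0) (hgr : g r ≤ 0) :
    ∃ R ∈ Ioc 0 r, g R = 0 ∧ ∀ s ∈ Ico 0 R, 0 < g s := by
  set S : Set ℝ := Icc 0 r ∩ g ⁻¹' Iic 0 with hS
  have hSc : IsCompact S := isCompact_Icc.of_isClosed_subset
    (hg.preimage_isClosed_of_isClosed isClosed_Icc isClosed_Iic) inter_subset_left
  obtain ⟨R, hR, hmin⟩ := hSc.exists_isLeast ⟨r, ⟨hr, le_rfl⟩, hgr⟩
  have hpos : ∀ s ∈ Ico 0 R, 0 < g s := by
    intro s hs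
    by_contra! hle
    exact absurd (hmin ⟨⟨hs.1, hs.2.le.trans hR.1.2⟩, hle⟩) hs.2.not_ge
  have hR0 : 0 < R := by
    rcases hR.1.1.eq_or_lt with h | h
    · rw [← h] at hR; exact absurd hR.2 h0.not_ge
    · exact h
  refine ⟨R, ⟨hR0, hR.1.2⟩, le_antisymm hR.2 ?_, hpos⟩
  have hcont : Tendsto g (𝓝[<] R) (𝓝 (g R)) :=
    ((hg R hR.1).mono_of_mem_nhdsWithin (mem_of_superset (Icc_mem_nhdsLT hR0)
      (Icc_subset_Icc_right hR.1.2)))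
  exact ge_of_tendsto hcont (by
    filter_upwards [Ico_mem_nhdsLT hR0] with s hs
    exact (hpos s hs).le)

lemma deriv_nonpos_of_pos_left {g : ℝ → ℝ} {D R : ℝ} (hR : 0 < R) (hd : HasDerivAt g D R)
    (h0 : g R = 0) (hpos : ∀ s ∈ Ico 0 R, 0 < g s) : D ≤ 0 := by
  have h1 := (hasDerivAt_iff_tendsto_slope.1 hd).mono_left
    (nhdsWithin_mono R (fun s hs => ne_of_lt hs : Iio R ⊆ {R}ᶜ))
  refine le_of_tendsto h1 ?_
  filter_upwards [Ico_mem_nhdsLT hR] with s hs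
  rw [slope_def_field, h0]
  exact div_nonpos_of_nonneg_of_nonpos (by linarith [hpos s hs]) (by linarith [hs.2])

/-- Integrating `r v' + k v > m r²` with the factor `r ^ (k - 1)`. -/
lemma mul_sq_lt_of_euler {v P : ℝ → ℝ} {k m ρ : ℝ} (hk : 0 < k) (hρ : 0 < ρ)
    (hv : ContinuousOn v (Icc 0 ρ)) (hd : ∀ r ∈ Ioo 0 ρ, HasDerivAt v (P r / r) r)
    (hΨ : ∀ r ∈ Ioo 0 ρ, 0 < P r + k * v r - m * r ^ 2) : m * ρ ^ 2 < (k + 2) * v ρ := by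
  set D : ℝ → ℝ := fun r => r ^ k * ((k + 2) * v r - m * r ^ 2) with hD
  have hDd : ∀ r ∈ Ioo 0 ρ, HasDerivAt D
      ((k + 2) * r ^ (k - 1) * (P r + k * v r - m * r ^ 2)) r := by
    intro r hr
    have hr0 : r ≠ 0 := hr.1.ne'
    have h1 := Real.hasDerivAt_rpow_const (x := r) (p := k) (Or.inl hr0)
    have h2 := ((hd r hr).const_mul (k + 2)).sub ((hasDerivAt_pow 2 r).const_mul m)
    refine (h1.mul h2).congr_deriv ?_
    have h3 : r ^ k = r ^ (k - 1) * r := by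
      rw [← Real.rpow_add_one hr0]; simp
    simp only [Pi.sub_apply]
    rw [h3]
    field_simp
    push_cast
    ring
  have hmono : StrictMonoOn D (Icc 0 ρ) := by
    refine strictMonoOn_of_deriv_pos (convex_Icc 0 ρ) ?_ fun r hr => ?_
    · exact (continuousOn_id.rpow_const fun _ _ => Or.inr hk.le).mul
        ((continuousOn_const.mul hv).sub (by fun_prop))
    · rw [interior_Icc] at hr
      rw [(hDd r hr).deriv]
      have := Real.rpow_pos_of_pos hr.1 (k - 1)
      have := hΨ r hr
      positivity
  have h := hmono ⟨le_rfl, hρ.le⟩ ⟨hρ.le, le_rfl⟩ hρ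
  simp only [hD, Real.zero_rpow hk.ne', zero_mul] at h
  have := pos_of_mul_pos_right h (Real.rpow_pos_of_pos hρ k).le
  linarith

/-- A lower bound for positive solutions of `v'' + (n - 1) v' / r = 1 + p v'²` with `p v ≥ q`: up to
the Joseph-Lundgren exponent they stay above the explicit solution `r² / (2n - 4q)` of the equation
with `p v = q`. Here `P = r v'`. -/
lemma sq_lt_mul_of_josephLundgren {n q R : ℝ} (hq : 0 < q) (hq1 : 4 * q < n - 2)
    (hq2 : 8 * q * (n - 2 * q) ≤ (n - 2) ^ 2) {v P p : ℝ → ℝ}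
    (hv : ContinuousOn v (Ico 0 R)) (hP : ContinuousOn P (Ico 0 R))
    (hvpos : ∀ r ∈ Ico 0 R, 0 < v r) (hP0 : P 0 = 0)
    (hvd : ∀ r ∈ Ioo 0 R, HasDerivAt v (P r / r) r)
    (hPd : ∀ r ∈ Ioo 0 R, HasDerivAt P (((2 - n) * P r + r ^ 2 + p r * P r ^ 2) / r) r)
    (hpq : ∀ r ∈ Ioo 0 R, q ≤ p r * v r) :
    ∀ r ∈ Ioo 0 R, r ^ 2 < (2 * n - 4 * q) * v r := by
  set b : ℝ := 2 * n - 4 * q with hb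
  have hb0 : 0 < b := by rw [hb]; linarith
  -- This `m` maximises the quadratic in `hquad`; its maximum is nonnegative exactly under `hq2`.
  -- The value of `k` is then forced by `m b = k + 2`.
  set m : ℝ := (n + 2 - 4 * q) / (2 * b) with hm
  set k : ℝ := (n - 2 - 4 * q) / 2 with hk
  have hk0 : 0 < k := by rw [hk]; linarith
  have hm0 : 0 < m := div_pos (by linarith) (by linarith)
  have hmb : m * b = k + 2 := by rw [hm, hk]; field_simp; ring
  have hquad : 0 ≤ -1 + (n + 2 - 4 * q) * m - b * m ^ 2 := by
    have h1 : -1 + (n + 2 - 4 * q) * m - b * m ^ 2 = ((n + 2 - 4 * q) ^ 2 - 4 * b) / (4 * b) := by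
      rw [hm]; field_simp; ring
    rw [h1]
    exact div_nonneg (by rw [hb]; nlinarith) (by linarith)
  -- With `Y = b v - r²` one has `b Ψ = r Y' + k Y`, so `Ψ > 0` says that `r^k Y` increases, hence
  -- `Y > 0`.
  set Ψ : ℝ → ℝ := fun r => P r + k * v r - m * r ^ 2 with hΨ
  have hΨc : ContinuousOn Ψ (Ico 0 R) :=
    (hP.add (continuousOn_const.mul hv)).sub (by fun_prop)
  have key : ∀ ρ ∈ Ioo 0 R, (∀ r ∈ Ioo 0 ρ, 0 < Ψ r) → ρ ^ 2 < b * v ρ := by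
    intro ρ hρ hpos
    have := mul_sq_lt_of_euler hk0 hρ.1 (hv.mono (Icc_subset_Ico_right hρ.2))
      (fun r hr => hvd r ⟨hr.1, hr.2.trans hρ.2⟩) hpos
    rw [← hmb, mul_assoc] at this
    exact lt_of_mul_lt_mul_left this hm0.le
  have hΨpos : ∀ r ∈ Ico 0 R, 0 < Ψ r := by
    intro r hr
    by_contra! hle
    have hΨ0 : 0 < Ψ 0 := by
      have := hvpos 0 ⟨le_rfl, hr.1.trans_lt hr.2⟩
      simp only [hΨ, hP0]; norm_num; positivity
    obtain ⟨ρ, hρ, hz, hpos⟩ := exists_first_zero hr.1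
      (hΨc.mono (Icc_subset_Ico_right hr.2)) hΨ0 hle
    have hρR : ρ ∈ Ioo 0 R := ⟨hρ.1, hρ.2.trans_lt hr.2⟩
    have hρ0 : ρ ≠ 0 := hρ.1.ne'
    have hlow := key ρ hρR fun s hs => hpos s ⟨hs.1.le, hs.2⟩
    have hder := ((hPd ρ hρR).add ((hvd ρ hρR).const_mul k)).sub
      ((hasDerivAt_pow 2 ρ).const_mul m)
    have hD := deriv_nonpos_of_pos_left hρ.1 hder hz hpos
    have hv0 := hvpos ρ ⟨hρ.1.le, hρR.2⟩
    set Y : ℝ := b * v ρ - ρ ^ 2 with hY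
    have hY0 : 0 < Y := by rw [hY]; linarith
    have hPe : P ρ = 2 * v ρ - m * Y := by
      have h1 : P ρ + k * v ρ - m * ρ ^ 2 = 0 := hz
      have h2 : m * Y = (k + 2) * v ρ - m * ρ ^ 2 := by rw [hY, ← hmb]; ring
      linarith
    have hD2 : (2 - n + k) * P ρ + (1 - 2 * m) * ρ ^ 2 + p ρ * P ρ ^ 2 ≤ 0 := by
      have h1 := mul_nonpos_of_nonneg_of_nonpos hρ.1.le hD
      have h2 : ρ * (((2 - n) * P ρ + ρ ^ 2 + p ρ * P ρ ^ 2) / ρ + k * (P ρ / ρ) -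
          m * (((2 : ℕ) : ℝ) * ρ ^ (2 - 1))) =
          (2 - n + k) * P ρ + (1 - 2 * m) * ρ ^ 2 + p ρ * P ρ ^ 2 := by
        field_simp
        push_cast
        ring
      linarith
    have h3 : q * P ρ ^ 2 ≤ p ρ * P ρ ^ 2 * v ρ := by
      nlinarith [hpq ρ hρR, sq_nonneg (P ρ)]
    have h4 := mul_nonpos_of_nonpos_of_nonneg hD2 hv0.le
    -- At a first zero of `Ψ` this quantity is at most `v ρ Ψ'`, which is nonpositive. Yet in terms
    -- of `Y > 0` it is a nonnegative term plus `q m² Y² > 0`.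
    have h5 : (2 - n + k) * P ρ * v ρ + (1 - 2 * m) * ρ ^ 2 * v ρ + q * P ρ ^ 2 =
        v ρ * Y * (-1 + (n + 2 - 4 * q) * m - b * m ^ 2) + q * m ^ 2 * Y ^ 2 := by
      have hX : ρ ^ 2 = b * v ρ - Y := by rw [hY]; ring
      rw [hPe, hX, show k = m * b - 2 by linarith, hb]
      ring
    have h6 : 0 ≤ v ρ * Y * (-1 + (n + 2 - 4 * q) * m - b * m ^ 2) :=
      mul_nonneg (mul_pos hv0 hY0).le hquad
    have h7 : 0 < q * m ^ 2 * Y ^ 2 := by positivity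
    nlinarith
  exact fun r hr => key r hr fun s hs => hΨpos s ⟨hs.1.le, hs.2.trans hr.2⟩

namespace IsRadialProfile
variable {N : ℕ} {f : ℝ → ℝ} {α : ℝ} {u W : ℝ → ℝ}

/-- The barrier applied to `v = F(u)`, for which `P = r v' = r² W / f(u)` and `p = f'(u)`. -/
lemma sq_lt_mul_F (h : IsRadialProfile N f α u W) (hf : IsNonlinearity f)
    (hu : ∀ r, |u r| ≤ α) {q R : ℝ} (hq : 0 < q) (hq1 : 4 * q < N - 2)
    (hq2 : 8 * q * (N - 2 * q) ≤ ((N : ℝ) - 2) ^ 2)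
    (hqf : ∀ s ∈ Ioc 0 α, q ≤ deriv f s * F f s) (hpos : ∀ r ∈ Ico 0 R, 0 < u r) :
    ∀ r ∈ Ioo 0 R, r ^ 2 < (2 * N - 4 * q) * F f (u r) := by
  have hfd := hf.differentiable
  have hW := h.continuous_W
  have hvd : ∀ r ∈ Ico 0 R, HasDerivAt (fun r => F f (u r)) (r * W r / f (u r)) r := by
    intro r hr
    refine ((hf.hasDerivAt_F (hpos r hr)).comp r (h.hasDerivAt r)).congr_deriv ?_
    ring
  have hPd : ∀ r ∈ Ico 0 R, HasDerivAt (fun r => r * (r * W r) / f (u r))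
      (((1 * (r * W r) + r * (f (u r) - (N - 1) * W r)) * f (u r) -
        r * (r * W r) * (deriv f (u r) * -(r * W r))) / f (u r) ^ 2) r := by
    intro r hr
    exact ((hasDerivAt_id r).mul (h.hasDerivAt_flux' hfd.continuous r)).div
      ((hfd (u r)).hasDerivAt.comp r (h.hasDerivAt r)) (hf.pos _ (hpos r hr)).ne'
  refine sq_lt_mul_of_josephLundgren (P := fun r => r * (r * W r) / f (u r))
    (p := fun r => deriv f (u r)) hq hq1 hq2
    (fun r hr => (hvd r hr).continuousAt.continuousWithinAt)
    (fun r hr => (hPd r hr).continuousAt.continuousWithinAt)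
    (fun r hr => hf.F_pos (hpos r hr)) (by simp) (fun r hr => ?_) (fun r hr => ?_) fun r hr => ?_
  · refine (hvd r (Ioo_subset_Ico_self hr)).congr_deriv ?_
    have := hr.1.ne'
    field_simp
  · have h0 := (hf.pos _ (hpos r (Ioo_subset_Ico_self hr))).ne'
    refine (hPd r (Ioo_subset_Ico_self hr)).congr_deriv ?_
    have := hr.1.ne'
    field_simp
    ring
  · exact hqf _ ⟨hpos r (Ioo_subset_Ico_self hr), (le_abs_self _).trans (hu r)⟩

/-- Under the pinching `q₁ ≤ f' F ≤ q₂` on `(0, α]`, with `q₁`, `q₂` below the Joseph-Lundgren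
threshold, Hardy's inequality gives stability. -/
lemma stabilityInequality_of_pinching (h : IsRadialProfile N f α u W) (hN : 2 ≤ N) (hα : 0 < α)
    (hf : IsNonlinearity f) (hu : ∀ r, |u r| ≤ α) {q₁ q₂ : ℝ} (hq : 0 < q₁)
    (hq1 : 4 * q₁ < N - 2) (hq2 : 8 * q₁ * (N - 2 * q₁) ≤ ((N : ℝ) - 2) ^ 2)
    (hH : q₂ * (2 * N - 4 * q₁) < (((N : ℝ) - 2) / 2) ^ 2)
    (hqf : ∀ s ∈ Ioc 0 α, q₁ ≤ deriv f s * F f s ∧ deriv f s * F f s ≤ q₂) :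
    StabilityInequality N f (radial N u) := by
  set H : ℝ := q₂ * (2 * N - 4 * q₁) with hHdef
  have hM : 0 < deriv f α := hf.deriv_pos α hα
  -- Adding `f'(u) r² ≤ H` and `f'(u) ε ≤ f'(α) ε` gives exactly the Hardy constant.
  set ε : ℝ := ((((N : ℝ) - 2) / 2) ^ 2 - H) / deriv f α with hε
  have hε0 : 0 < ε := div_pos (by linarith) hM
  have hcu := h.continuous
  have hcf' := hf.continuous_deriv
  have hV : Continuous fun x : EuclideanSpace ℝ (Fin N) => deriv f (u ‖x‖) := by fun_prop
  have hbd : ∀ R, (∀ r ∈ Ico 0 R, 0 < u r) → ∀ r ∈ Ico 0 R,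
      deriv f (u r) ≤ (((N : ℝ) - 2) / 2) ^ 2 / (r ^ 2 + ε) := by
    intro R hpos r hr
    have h2 : deriv f (u r) * ε ≤ (((N : ℝ) - 2) / 2) ^ 2 - H := by
      calc deriv f (u r) * ε ≤ deriv f α * ε :=
            mul_le_mul_of_nonneg_right (hf.deriv_le_of_abs_le (hu r)) hε0.le
        _ = _ := by rw [hε]; field_simp
    have h1 : deriv f (u r) * r ^ 2 ≤ H := by
      have h3 := hqf (u r) ⟨hpos r hr, (le_abs_self _).trans (hu r)⟩
      have hb : 0 ≤ (2 * N - 4 * q₁ : ℝ) := by linarith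
      have h5 : r ^ 2 ≤ (2 * N - 4 * q₁) * F f (u r) := by
        rcases hr.1.eq_or_lt with h0 | h0
        · rw [← h0]
          have := (hf.F_pos (hpos 0 ⟨le_rfl, h0 ▸ hr.2⟩)).le
          norm_num
          positivity
        · exact (h.sq_lt_mul_F hf hu hq hq1 hq2 (fun s hs => (hqf s hs).1) hpos r ⟨h0, hr.2⟩).le
      calc deriv f (u r) * r ^ 2 ≤ deriv f (u r) * ((2 * N - 4 * q₁) * F f (u r)) :=
            mul_le_mul_of_nonneg_left h5 (hf.deriv_nonneg _)
        _ = (deriv f (u r) * F f (u r)) * (2 * N - 4 * q₁) := by ring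
        _ ≤ H := mul_le_mul_of_nonneg_right h3.2 hb
    rw [le_div_iff₀ (by positivity)]
    linarith
  -- Up to a first zero the Hardy bound is available, while `f(u) < f'(u) u` yields a
  -- negative-energy test function supported in that ball. The two are incompatible.
  have hpos : ∀ r, 0 ≤ r → 0 < u r := by
    intro r hr
    by_contra! hle
    obtain ⟨R, hR, hz, hRpos⟩ := exists_first_zero hr hcu.continuousOn (by rwa [h.init]) hle
    obtain ⟨φ, hφ, hs, hsupp, hneg⟩ := exists_test_function_neg hN (z := u) (Z := W)
      (k := fun r => f (u r)) (V := fun r => deriv f (u r)) hR.1 h.continuous_W h.hasDerivAt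
      (h.hasDerivAt_flux' hf.differentiable.continuous)
      (hf.differentiable.continuous.comp hcu) (hcf'.comp hcu) (fun r => hf.deriv_nonneg _)
      hRpos hz (fun r hr => hf.lt_deriv_mul (hRpos r (Ioo_subset_Ico_self hr)))
    exact hneg.not_ge (integral_nonneg_of_le_hardy hN hφ hs hV hε0 fun x hx =>
      hbd R hRpos _ ⟨norm_nonneg x, hsupp x hx⟩)
  intro φ hφ hs
  exact integral_nonneg_of_le_hardy hN hφ hs hV hε0 fun x _ =>
    hbd (‖x‖ + 1) (fun r hr => hpos r hr.1) _ ⟨norm_nonneg x, by linarith⟩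

end IsRadialProfile

/-- `qJL N` is the smaller root of `16q² - 8Nq + (N-2)²`. Below it `q(2N-4q) < (N-2)²/4`, a strict
inequality that survives replacing `q₀` by nearby `q₁ < q₀ < q₂`. -/
lemma exists_pinching {N : ℕ} (hN : 3 ≤ N) {f : ℝ → ℝ} {q₀ : ℝ}
    (hlim : Tendsto (fun u => deriv f u * F f u) (𝓝[>] 0) (𝓝 q₀)) (hq₀ : 0 < q₀)
    (hq : q₀ < qJL N) :
    ∃ q₁ q₂ α₀ : ℝ, 0 < q₁ ∧ 4 * q₁ < N - 2 ∧ 8 * q₁ * (N - 2 * q₁) ≤ ((N : ℝ) - 2) ^ 2 ∧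
      q₂ * (2 * N - 4 * q₁) < (((N : ℝ) - 2) / 2) ^ 2 ∧ 0 < α₀ ∧
      ∀ s ∈ Ioo 0 α₀, q₁ ≤ deriv f s * F f s ∧ deriv f s * F f s ≤ q₂ := by
  have hN' : (3 : ℝ) ≤ N := by exact_mod_cast hN
  have hs2 : Real.sqrt ((N : ℝ) - 1) ^ 2 = N - 1 := Real.sq_sqrt (by linarith)
  have hs1 : 1 < Real.sqrt ((N : ℝ) - 1) := Real.lt_sqrt_of_sq_lt (by linarith)
  set s := Real.sqrt ((N : ℝ) - 1) with hs
  unfold qJL at hq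
  have h4 : 2 * s < N - 4 * q₀ := by linarith
  have h5 : q₀ * (2 * N - 4 * q₀) < (((N : ℝ) - 2) / 2) ^ 2 := by nlinarith
  have hcont : Continuous fun t : ℝ => (q₀ + t) * (2 * N - 4 * (q₀ - t)) := by fun_prop
  have hev1 : ∀ᶠ t in 𝓝[>] (0 : ℝ), (q₀ + t) * (2 * N - 4 * (q₀ - t)) < (((N : ℝ) - 2) / 2) ^ 2 :=
    nhdsWithin_le_nhds ((hcont.tendsto 0).eventually_lt_const (by simpa using h5))
  obtain ⟨t, ht1, ht2⟩ := (hev1.and (Ioo_mem_nhdsGT hq₀)).exists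
  have hev2 := hlim.eventually (Icc_mem_nhds (show q₀ - t < q₀ by linarith [ht2.1])
    (show q₀ < q₀ + t by linarith [ht2.1]))
  obtain ⟨α₀, hα₀, hsub⟩ := (mem_nhdsGT_iff_exists_Ioo_subset).1 hev2
  have ht := ht2.1
  exact ⟨q₀ - t, q₀ + t, α₀, by linarith [ht2.2], by linarith, by nlinarith, ht1, hα₀,
    fun s hs => hsub hs⟩

end StableRadial

/-! ### Ordering of solutions and the stability threshold. -/

namespace StableRadial
namespace IsRadialProfile
variable {N : ℕ} {f : ℝ → ℝ} {α β : ℝ} {u W v V : ℝ → ℝ}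

/-- Below a stable solution, solutions are positive and ordered. -/
lemma pos_and_lt_of_stabilityInequality (h : IsRadialProfile N f α u W)
    (k : IsRadialProfile N f β v V) (hN : 2 ≤ N) (hα : 0 < α) (hαβ : α < β)
    (hf : IsNonlinearity f) (hst : StabilityInequality N f (radial N v)) :
    ∀ r, 0 ≤ r → 0 < u r ∧ u r < v r := by
  have hfc := hf.differentiable.continuous
  -- Positivity and ordering are proved together: the ordering gives `f'(u) ≤ f'(v)` when `u` is
  -- tested, and positivity gives convexity when `v - u` is tested.
  have hmain : ∀ r, 0 ≤ r → 0 < min (u r) (v r - u r) := by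
    intro r hr
    by_contra! hle
    have hc : Continuous fun r => min (u r) (v r - u r) :=
      h.continuous.min (k.continuous.sub h.continuous)
    obtain ⟨R, hR, hz, hpos⟩ := exists_first_zero hr hc.continuousOn
      (by simp [h.init, k.init, hα, hαβ]) hle
    have hu : ∀ r ∈ Ico 0 R, 0 < u r := fun r hr => (lt_min_iff.1 (hpos r hr)).1
    have hvu : ∀ r ∈ Ico 0 R, 0 < v r - u r := fun r hr => (lt_min_iff.1 (hpos r hr)).2
    have hV : Continuous fun r => deriv f (v r) := hf.continuous_deriv.comp k.continuous
    rcases min_choice (u R) (v R - u R) with he | he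
    · obtain ⟨φ, hφ, hs, -, hneg⟩ := exists_test_function_neg hN (z := u) (Z := W)
        (k := fun r => f (u r)) hR.1 h.continuous_W h.hasDerivAt (h.hasDerivAt_flux' hfc)
        (hfc.comp h.continuous) hV (fun r => hf.deriv_nonneg _) hu (by rw [← he, hz])
        (fun r hr => by
          have hr' := Ioo_subset_Ico_self hr
          refine (hf.lt_deriv_mul (hu r hr')).trans_le ?_
          refine mul_le_mul_of_nonneg_right (hf.deriv_le_of_abs_le ?_) (hu r hr').le
          rw [abs_of_pos (hu r hr')]
          linarith [hvu r hr'])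
      exact hneg.not_ge (hst φ hφ hs)
    · obtain ⟨φ, hφ, hs, -, hneg⟩ := exists_test_function_neg hN (z := fun r => v r - u r)
        (Z := fun r => V r - W r) (k := fun r => f (v r) - f (u r)) hR.1
        (k.continuous_W.sub h.continuous_W)
        (fun r => ((k.hasDerivAt r).sub (h.hasDerivAt r)).congr_deriv (by ring))
        (fun r => by
          have := ((k.hasDerivAt_flux' hfc r).sub (h.hasDerivAt_flux' hfc r)).congr_deriv
            (show _ = f (v r) - f (u r) - (N - 1) * (V r - W r) by ring)
          refine this.congr_of_eventuallyEq (Eventually.of_forall fun s => ?_)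
          simp only [Pi.sub_apply]; ring)
        ((hfc.comp k.continuous).sub (hfc.comp h.continuous)) hV (fun r => hf.deriv_nonneg _) hvu
        (by rw [← he, hz])
        (fun r hr => by
          have hr' := Ioo_subset_Ico_self hr
          exact hf.sub_lt_deriv_mul (hu r hr').le (by linarith [hvu r hr']))
      exact hneg.not_ge (hst φ hφ hs)
  intro r hr
  have := lt_min_iff.1 (hmain r hr)
  exact ⟨this.1, by linarith [this.2]⟩

lemma continuous_potential (h : IsRadialProfile N f α u W) (hf : IsNonlinearity f) :
    Continuous fun x => deriv f (radial N u x) :=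
  hf.continuous_deriv.comp (h.continuous.comp continuous_norm)

/-- Since `0 < u < v` and `f'` increases on `[0,∞)`, the potential of `u` is the smaller one. -/
lemma stabilityInequality_of_lt (h : IsRadialProfile N f α u W)
    (k : IsRadialProfile N f β v V) (hN : 2 ≤ N) (hα : 0 < α) (hαβ : α < β)
    (hf : IsNonlinearity f) (hst : StabilityInequality N f (radial N v)) :
    StabilityInequality N f (radial N u) := by
  intro φ hφ hs
  have hord := h.pos_and_lt_of_stabilityInequality k hN hα hαβ hf hst
  obtain ⟨h1, h2⟩ := integrable_gradient_sq_sub hφ hs (h.continuous_potential (N := N) hf)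
  obtain ⟨-, h3⟩ := integrable_gradient_sq_sub hφ hs (k.continuous_potential (N := N) hf)
  refine (hst φ hφ hs).trans (integral_mono (h1.sub h3) (h1.sub h2) fun x => ?_)
  have hx := hord ‖x‖ (norm_nonneg x)
  have : deriv f (radial N u x) ≤ deriv f (radial N v x) :=
    hf.deriv_le_of_abs_le (by
      change |u ‖x‖| ≤ v ‖x‖
      rw [abs_of_pos hx.1]; exact hx.2.le)
  exact sub_le_sub_left (mul_le_mul_of_nonneg_right this (sq_nonneg _)) _

end IsRadialProfile

/-- Stability passes to the limit from below along the family of radial solutions. -/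
lemma stabilityInequality_of_forall_lt {N : ℕ} (hN : 1 ≤ N) {f : ℝ → ℝ} (hf : IsNonlinearity f)
    {u W : ℝ → ℝ → ℝ}
    (hu : ∀ α, 0 < α → IsRadialProfile N f α (u α) (W α) ∧ ∀ r, |u α r| ≤ α) {β : ℝ} (hβ : 0 < β)
    (hst : ∀ α ∈ Ioo 0 β, StabilityInequality N f (radial N (u α))) :
    StabilityInequality N f (radial N (u β)) := by
  intro φ hφ hs
  have hev : ∀ᶠ α in 𝓝[<] β, α ∈ Ioo 0 β := Ioo_mem_nhdsLT hβ
  have hint := fun α (hα : 0 < α) =>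
    integrable_gradient_sq_sub hφ hs ((hu α hα).1.continuous_potential (N := N) hf)
  have hlim : ∀ r, 0 ≤ r → Tendsto (fun α => u α r) (𝓝[<] β) (𝓝 (u β r)) := by
    intro r hr
    rw [tendsto_iff_dist_tendsto_zero]
    have hc : Tendsto (fun α => √(Real.exp ((1 + deriv f β) * r) * (α - β) ^ 2)) (𝓝[<] β) (𝓝 0) := by
      have : Continuous fun α => √(Real.exp ((1 + deriv f β) * r) * (α - β) ^ 2) := by fun_prop
      have := (this.tendsto β).mono_left (nhdsWithin_le_nhds (s := Iio β))
      simpa using this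
    refine squeeze_zero' (Eventually.of_forall fun _ => dist_nonneg) ?_ hc
    filter_upwards [hev] with α hα
    rw [Real.dist_eq]
    refine Real.abs_le_sqrt ?_
    exact (hu α hα.1).1.sub_sq_le (hu β hβ).1 hN hf hr
      (fun s => ((hu α hα.1).2 s).trans hα.2.le) (hu β hβ).2
  have hcont := integrable_gradient_sq_sub hφ hs (V := fun _ => deriv f β) continuous_const
  -- Domination is uniform because `|u α| ≤ α < β` bounds every potential by `f'(β)`.
  refine ge_of_tendsto (tendsto_integral_filter_of_dominated_convergence
    (fun x => ‖gradient φ x‖ ^ 2 + deriv f β * φ x ^ 2) ?_ ?_ (hcont.1.add hcont.2) ?_)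
    (hev.mono fun α hα => hst α hα φ hφ hs)
  · filter_upwards [hev] with α hα
    exact ((hint α hα.1).1.sub (hint α hα.1).2).aestronglyMeasurable
  · filter_upwards [hev] with α hα
    refine Eventually.of_forall fun x => ?_
    have h1 : deriv f (radial N (u α) x) ≤ deriv f β :=
      hf.deriv_le_of_abs_le (((hu α hα.1).2 _).trans hα.2.le)
    have h2 := hf.deriv_nonneg (radial N (u α) x)
    rw [Real.norm_eq_abs, abs_le]
    constructor <;> nlinarith [sq_nonneg (φ x), sq_nonneg ‖gradient φ x‖]
  · refine Eventually.of_forall fun x => ?_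
    refine tendsto_const_nhds.sub (Tendsto.mul_const _ ?_)
    exact (hf.continuous_deriv.tendsto _).comp (hlim _ (norm_nonneg x))

/-- A family that is stable for small `α`, with stability inherited downwards and closed from below,
has structure (II) or (III). -/
lemma structureII_or_structureIII {N : ℕ} (hN : 2 ≤ N) {f : ℝ → ℝ} (hf : IsNonlinearity f)
    {u W : ℝ → ℝ → ℝ}
    (hu : ∀ α, 0 < α → IsRadialProfile N f α (u α) (W α) ∧ ∀ r, |u α r| ≤ α)
    {α₀ : ℝ} (hα₀ : 0 < α₀) (hst : StabilityInequality N f (radial N (u α₀))) :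
    StructureII N f u ∨ StructureIII N f u := by
  have hent : ∀ α, 0 < α → IsEntireSolution N f (radial N (u α)) := fun α hα =>
    (hu α hα).1.isEntireSolution (by omega) hf.differentiable.continuous
  set T : Set ℝ := {α | 0 < α ∧ StabilityInequality N f (radial N (u α))} with hT
  have hdown : ∀ β ∈ T, ∀ α, 0 < α → α < β → α ∈ T := fun β hβ α hα hαβ =>
    ⟨hα, (hu α hα).1.stabilityInequality_of_lt (hu β hβ.1).1 hN hα hαβ hf hβ.2⟩
  have hmono : ∀ r, 0 < r → StrictMonoOn (fun α => u α r) T := fun r hr α hα β hβ hαβ =>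
    ((hu α hα.1).1.pos_and_lt_of_stabilityInequality (hu β hβ.1).1 hN hα.1 hαβ hf hβ.2 r hr.le).2
  by_cases hall : ∀ α, 0 < α → α ∈ T
  · exact Or.inl ⟨fun α hα => ⟨hent α hα, (hall α hα).2⟩,
      fun r hr => (hmono r hr).mono fun α hα => hall α hα⟩
  · push Not at hall
    obtain ⟨γ, hγ0, hγ⟩ := hall
    have hbdd : BddAbove T := ⟨γ, fun β hβ => by
      by_contra! hlt
      exact hγ (hdown β hβ γ hγ0 hlt)⟩
    have hmem₀ : α₀ ∈ T := ⟨hα₀, hst⟩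
    have hpos : 0 < sSup T := hα₀.trans_le (le_csSup hbdd hmem₀)
    have hbelow : ∀ α ∈ Ioo 0 (sSup T), α ∈ T := by
      intro α hα
      obtain ⟨β, hβ, hαβ⟩ := exists_lt_of_lt_csSup ⟨α₀, hmem₀⟩ hα.2
      exact hdown β hβ α hα.1 hαβ
    -- The threshold is the supremum of the stable parameters; closedness from below makes it stable
    -- itself.
    refine Or.inr ⟨sSup T, hpos, fun α hα => ⟨hent α hα.1, ?_⟩, fun α hα => ⟨hent α
      (hpos.trans hα), fun hs => ?_⟩, fun r hr => (hmono r hr).mono hbelow⟩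
    · rcases hα.2.eq_or_lt with h | h
      · rw [h]
        exact stabilityInequality_of_forall_lt (by omega) hf hu hpos fun β hβ => (hbelow β hβ).2
      · exact (hbelow α ⟨hα.1, h⟩).2
    · exact hα.not_ge (le_csSup hbdd ⟨hpos.trans hα, hs⟩)

end StableRadial

open StableRadial in
/-- Here `u α r` is the value at `r ≥ 0` of the unique solution `u(r, α)` of the radial problem. -/
theorem corollary1p3 (N : ℕ) (hN : 11 ≤ N) (f : ℝ → ℝ) (hf : IsNonlinearity f)
    (q₀ : ℝ) (hlim : Tendsto (fun u => deriv f u * F f u) (𝓝[>] 0) (𝓝 q₀))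
    (hq₁ : 1 < q₀) (hq₂ : q₀ < qJL N) :
    ∃ u : ℝ → ℝ → ℝ,
      (∀ α, 0 < α → IsRadialSolution N f α (u α) ∧
        ∀ v, IsRadialSolution N f α v → EqOn v (u α) (Ici 0)) ∧
      (∃ α₀, 0 < α₀ ∧ ∀ α ∈ Ioo 0 α₀, IsStableSolution N f (radial N (u α))) ∧
      (StructureII N f u ∨ StructureIII N f u) := by
  choose! u W hu using fun α (hα : 0 < α) =>
    exists_isRadialProfile (N := N) (by omega) hf hα
  obtain ⟨q₁, q₂, α₁, hq, hq1, hq2, hH, hα₁, hpinch⟩ :=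
    exists_pinching (N := N) (by omega) hlim (by linarith) hq₂
  have hst : ∀ α ∈ Ioo 0 α₁, StabilityInequality N f (radial N (u α)) := fun α hα =>
    (hu α hα.1).1.stabilityInequality_of_pinching (by omega) hα.1 hf (hu α hα.1).2 hq hq1 hq2 hH
      fun s hs => hpinch s ⟨hs.1, hs.2.trans_lt hα.2⟩
  refine ⟨u, fun α hα => ⟨(hu α hα).1.isRadialSolution hf.differentiable.continuous, fun v hv =>
    (hu α hα).1.eqOn_of_isRadialSolution (by omega) hf hv⟩, ⟨α₁, hα₁, fun α hα =>
    ⟨(hu α hα.1).1.isEntireSolution (by omega) hf.differentiable.continuous, hst α hα⟩⟩, ?_⟩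
  exact structureII_or_structureIII (by omega) hf hu (half_pos hα₁)
    (hst _ ⟨half_pos hα₁, half_lt_self hα₁⟩)
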